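/- We work over $\mathbb{C}$. A surface $X$ of degree $d$ in $\mathbb{P}^3$ is the zero scheme of a nonzero form $f$ of degree $d$ (irreducibility need not be assumed in advance). A smooth point $P$ of $X$ is a \emph{star point} if the scheme $T_P(X)\cap X$ is a cone with vertex $P$, where $T_P(X)$ is the embedded tangent plane. A point of $X$ is a singularity of type $A_n$ ($n\ge 1$) if in suitable formal local coordinates of $\mathbb{P}^3$ centred at that point $X$ has the equation $z_0^2+z_1^2+z_2^{n+1}=0$. \textbf{Theorem.} Let $X$ be a surface of degree $d\ge 3$ in $\mathbb{P}^3$, let $\Lambda\not\subset\operatorname{Sing}(X)$ be a line containing (at least) $d-1$ distinct singularities of $X$ of type $A_{d-1}$, and let $P\in\Lambda$ be a smooth star point of $X$. Then there is an algebraic one-parameter family of triples $(X(t),\Lambda(t),P(t))$, $t\in\mathbb{C}$, each consisting of a surface of degree $d$ in $\mathbb{P}^3$, a line in $\mathbb{P}^3$ and a point of $\mathbb{P}^3$, all depending polynomially on $t$, with $$(X(0),\Lambda(0),P(0))=(X,\Lambda,P),$$ such that for every $t\ne 0$ the surface $X(t)$ is irreducible and reduced, the line $\Lambda(t)$ contains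 exactly $d-1$ singularities of $X(t)$ of type $A_{d-2}$, and $P(t)$ is a smooth star point of $X(t)$ lying on $\Lambda(t)$. -/

import Mathlib

open scoped LinearAlgebra.Projectivization

noncomputable section

/-- The coordinate space `ℂ⁴`; its projectivization is `ℙ³`. -/
abbrev V4 : Type := Fin 4 → ℂ

/-- The complex projective space `ℙ³`. -/
abbrev P3 : Type := ℙ ℂ V4

/-- The point `P` of `ℙ³` lies on the projectivization of the linear subspace `L` of `ℂ⁴`
(for a line of `ℙ³`, `L` has dimension two). -/
def LiesOn (P : P3) (L : Submodule ℂ V4) : Prop :=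
  P.submodule ≤ L

/-- `P` is a singular point of the surface `f = 0` (for `f` homogeneous this does not depend on the
chosen representative of `P`, and the same holds for all definitions below). -/
def IsSingularPoint (f : MvPolynomial (Fin 4) ℂ) (P : P3) : Prop :=
  MvPolynomial.eval P.rep f = 0 ∧ ∀ i, MvPolynomial.eval P.rep (MvPolynomial.pderiv i f) = 0

/-- `P` is a smooth point of the surface `f = 0`. -/
def IsSmoothPoint (f : MvPolynomial (Fin 4) ℂ) (P : P3) : Prop :=
  MvPolynomial.eval P.rep f = 0 ∧ ∃ i, MvPolynomial.eval P.rep (MvPolynomial.pderiv i f) ≠ 0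

/-- The embedded tangent space at `P` of the surface `f = 0`, given by `∑ᵢ ∂ᵢf(P) Xᵢ = 0`. -/
def tangentSpaceAt (f : MvPolynomial (Fin 4) ℂ) (P : P3) : Submodule ℂ V4 :=
  LinearMap.ker (∑ i, MvPolynomial.eval P.rep (MvPolynomial.pderiv i f) •
    (LinearMap.proj i : V4 →ₗ[ℂ] ℂ))

/-- The intersection of the surface `f = 0` with the linear subspace `T` is, as a scheme, a cone with
vertex `P` (a point of `T`): the restriction of the form `f` to `T` is invariant under translation
in the direction `P`, i.e. it only involves linear forms on `T` that vanish at `P`. -/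
def IsConeWithVertex (f : MvPolynomial (Fin 4) ℂ) (T : Submodule ℂ V4) (P : P3) : Prop :=
  LiesOn P T ∧
    ∀ v ∈ T, ∀ c : ℂ, MvPolynomial.eval (v + c • P.rep) f = MvPolynomial.eval v f

/-- `P` is a smooth star point of the surface `f = 0`. -/
def IsSmoothStarPoint (f : MvPolynomial (Fin 4) ℂ) (P : P3) : Prop :=
  IsSmoothPoint f P ∧ IsConeWithVertex f (tangentSpaceAt f P) P

/-- The equation `f(p + x₀ v₀ + x₁ v₁ + x₂ v₂)` of the surface `f = 0` in the affine chart
`x ↦ p + x₀ v₀ + x₁ v₁ + x₂ v₂` of `ℙ³`, where `p` is a representative of `P`. If `p, v₀, v₁, v₂` is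
a basis of `ℂ⁴`, this is a chart whose origin is `P`. -/
def localEquation (f : MvPolynomial (Fin 4) ℂ) (P : P3) (v : Fin 3 → V4) :
    MvPolynomial (Fin 3) ℂ :=
  MvPolynomial.bind₁ (fun i => MvPolynomial.C (P.rep i) +
    ∑ j, MvPolynomial.C (v j i) * MvPolynomial.X j) f

/-- `z₀, z₁, z₂` is a system of formal local coordinates at the origin of `ℂ³`: the `zᵢ` vanish at
the origin and their Jacobian determinant does not. -/
def IsFormalCoordinates (z : Fin 3 → MvPowerSeries (Fin 3) ℂ) : Prop :=
  (∀ i, MvPowerSeries.constantCoeff (z i) = 0) ∧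
    (Matrix.of fun i j => MvPowerSeries.coeff (Finsupp.single j 1) (z i)).det ≠ 0

/-- `P` is a singularity of type `A_n` (`n ≥ 1`) of the surface `f = 0`: in suitable formal local
coordinates at `P` the surface has equation `z₀² + z₁² + z₂ⁿ⁺¹ = 0`, that is, this series is a unit
times the local equation of the surface in an affine chart centred at `P`. -/
def IsTypeA (n : ℕ) (f : MvPolynomial (Fin 4) ℂ) (P : P3) : Prop :=
  ∃ v : Fin 3 → V4, LinearIndependent ℂ (Fin.cons P.rep v : Fin 4 → V4) ∧
    ∃ (z : Fin 3 → MvPowerSeries (Fin 3) ℂ) (u : MvPowerSeries (Fin 3) ℂ),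
      IsFormalCoordinates z ∧ IsUnit u ∧
        u * (localEquation f P v : MvPowerSeries (Fin 3) ℂ) = z 0 ^ 2 + z 1 ^ 2 + z 2 ^ (n + 1)

/-- The set of singularities of type `A_n` of the surface `f = 0` lying on `L`. -/
def typeAOn (n : ℕ) (f : MvPolynomial (Fin 4) ℂ) (L : Submodule ℂ V4) : Set P3 :=
  {Q | LiesOn Q L ∧ IsTypeA n f Q}

/-- An algebraic one-parameter family, parametrized by the affine line, of triples consisting of a
surface of degree `d`, a line and a point in `ℙ³`: the coefficients of the equation, two spanning
vectors of the line, and the homogeneous coordinates of the point are polynomials in the parameter,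
and for no value of the parameter they degenerate. -/
structure TripleFamily (d : ℕ) where
  form : MvPolynomial (Fin 4) (Polynomial ℂ)
  isHomogeneous : form.IsHomogeneous d
  form_ne_zero : ∀ t : ℂ, MvPolynomial.map (Polynomial.evalRingHom t) form ≠ 0
  lineVec : Fin 2 → Fin 4 → Polynomial ℂ
  line_indep : ∀ t : ℂ,
    LinearIndependent ℂ (fun k => (fun i => (lineVec k i).eval t : V4))
  pointVec : Fin 4 → Polynomial ℂ
  point_ne_zero : ∀ t : ℂ, (fun i => (pointVec i).eval t : V4) ≠ 0

namespace TripleFamily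

variable {d : ℕ}

/-- The equation of the surface `X(t)`. -/
def X (F : TripleFamily d) (t : ℂ) : MvPolynomial (Fin 4) ℂ :=
  MvPolynomial.map (Polynomial.evalRingHom t) F.form

/-- The line `Λ(t)`. -/
def line (F : TripleFamily d) (t : ℂ) : Submodule ℂ V4 :=
  Submodule.span ℂ (Set.range fun k => (fun i => (F.lineVec k i).eval t : V4))

/-- The point `P(t)`. -/
def point (F : TripleFamily d) (t : ℂ) : P3 :=
  Projectivization.mk ℂ (fun i => (F.pointVec i).eval t : V4) (F.point_ne_zero t)

end TripleFamily

end

noncomputable section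

open MvPolynomial

/-! ### Homogeneous polynomials and derivations under substitution -/

namespace MvPolynomial

/-! Choose a basis `p, e₁, e₂, e₃` of `ℂ⁴` with `p` over `P`, `L = ⟨p, e₁⟩` and tangent space `T =
⟨p, e₁, e₂⟩`, and let `ξ₁, ξ₂` be the coordinates dual to `e₁, e₂`. The family is `f + t ξ₂^(d-1)
ξ₁`, with `L` and `P` fixed.

Counting roots of derivatives shows that `f` vanishes on `L`, so `L ⊂ T`. On `L` the form `g =
∂f/∂e₃` has degree `d - 1` and is nonzero at `P`; hence its zeros there are exactly the `d - 1`
given singularities, and they are simple.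

The heart is that `f|_T = c ξ₂^d` (`IsTypeA.lineRestrict_eq`). By the star property `f|_T` does not
depend on the `p`-direction. Near a singularity `Q`, the simple zero of `g` gives a formal arc in
`T` on which both `∂f/∂p` and `∂f/∂e₃` vanish. If `f` had order `m < d` on this arc, the normal form
`z₀² + z₁² + z₂^d` would force `z₀` and `z₁` to have order at least `m`, hence `f` to have order
greater than `m` (`no_low_order_arc`).

After the perturbation the restriction to `T` is `ξ₂^(d-1) (c ξ₂ + t ξ₁)`, where `ξ₁` does not
vanish at the singularities. Together with the simple zeros of `g`, which is unchanged, this is the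
normal form of `A_{d-2}` (`isTypeA_of_eval_plane`). The perturbation is singular along `L` and
invariant under `p`, so `P` remains a smooth star point. Singularities on `L` are still zeros of
`g`, hence at most `d - 1`. Irreducibility holds because the restriction to `T` is now a nonzero
cone over a smooth point (`irreducible_of_smooth_of_invariant`). -/

theorem aeval_smul_of_isHomogeneous {σ R A : Type*} [CommSemiring R] [CommSemiring A] [Algebra R A]
    {f : MvPolynomial σ R} {n : ℕ} (hf : f.IsHomogeneous n) (c : A) (w : σ → A) :
    aeval (c • w) f = c ^ n * aeval w f := by
  simp only [aeval_def, eval₂_eq, Finset.mul_sum]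
  refine Finset.sum_congr rfl fun m hm => ?_
  have h : ∑ i ∈ m.support, m i = n := by
    have := hf.degree_eq_sum_deg_support hm
    simpa [Finsupp.degree] using this.symm
  simp only [Pi.smul_apply, smul_eq_mul, mul_pow, Finset.prod_mul_distrib]
  rw [Finset.prod_pow_eq_pow_sum, h]
  ring

/-- Along a parametrized line the coefficient of top degree is the value at the point at infinity.
The coefficient ring is general because the formal arcs need polynomials over `ℂ⟦X⟧`. -/
theorem coeff_aeval_of_isHomogeneous {σ R A : Type*} [CommSemiring R]
    [CommSemiring A] [Algebra R A] {f : MvPolynomial σ R} {n : ℕ} (hf : f.IsHomogeneous n)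
    (p : σ → Polynomial A) (hp : ∀ i, (p i).natDegree ≤ 1) :
    (aeval p f).coeff n = aeval (fun i => (p i).coeff 1) f := by
  simp only [aeval_def, eval₂_eq, Polynomial.finsetSum_coeff]
  refine Finset.sum_congr rfl fun m hm => ?_
  have h : ∑ i ∈ m.support, m i = n := by
    have := hf.degree_eq_sum_deg_support hm
    simpa [Finsupp.degree] using this.symm
  rw [IsScalarTower.algebraMap_apply R A (Polynomial A), Polynomial.algebraMap_eq,
    Polynomial.coeff_C_mul]
  congr 1
  have key : ∀ s : Finset σ, (∏ i ∈ s, p i ^ m i).natDegree ≤ ∑ i ∈ s, m i ∧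
      (∏ i ∈ s, p i ^ m i).coeff (∑ i ∈ s, m i) = ∏ i ∈ s, (p i).coeff 1 ^ m i := by
    classical
    intro s
    have hpow : ∀ i, (p i ^ m i).natDegree ≤ m i := fun i =>
      Polynomial.natDegree_pow_le.trans (by simpa using Nat.mul_le_mul_left (m i) (hp i))
    refine ⟨(Polynomial.natDegree_prod_le _ _).trans (Finset.sum_le_sum fun i _ => hpow i), ?_⟩
    induction s using Finset.induction_on with
    | empty => simp
    | insert a s ha ih =>
      rw [Finset.prod_insert ha, Finset.sum_insert ha, Finset.prod_insert ha,
        Polynomial.coeff_mul_add_eq_of_natDegree_le (hpow a)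
          ((Polynomial.natDegree_prod_le _ _).trans (Finset.sum_le_sum fun i _ => hpow i)), ih]
      have := Polynomial.coeff_pow_of_natDegree_le (m := m a) (hp a)
      rw [mul_one] at this
      rw [this]
  rw [← h]
  exact (key _).2

theorem natDegree_aeval_le_of_isHomogeneous {σ R A : Type*} [CommSemiring R]
    [CommSemiring A] [Algebra R A] {f : MvPolynomial σ R} {n : ℕ} (hf : f.IsHomogeneous n)
    (p : σ → Polynomial A) (hp : ∀ i, (p i).natDegree ≤ 1) : (aeval p f).natDegree ≤ n := by
  rw [aeval_def, eval₂_eq]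
  refine Polynomial.natDegree_sum_le_of_forall_le _ _ fun m hm => ?_
  have h : ∑ i ∈ m.support, m i = n := by
    have := hf.degree_eq_sum_deg_support hm
    simpa [Finsupp.degree] using this.symm
  rw [IsScalarTower.algebraMap_apply R A (Polynomial A), Polynomial.algebraMap_eq, ← h]
  refine (Polynomial.natDegree_C_mul_le _ _).trans ((Polynomial.natDegree_prod_le _ _).trans
    (Finset.sum_le_sum fun i _ => Polynomial.natDegree_pow_le.trans ?_))
  simpa using Nat.mul_le_mul_left (m i) (hp i)

/-- The chain rule, used for partial derivatives in charts and for derivatives along lines. -/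
theorem derivation_aeval {σ R A : Type*} [Fintype σ] [CommSemiring R] [CommSemiring A]
    [Algebra R A] (D : Derivation R A A) (w : σ → A) (f : MvPolynomial σ R) :
    D (aeval w f) = ∑ i, D (w i) * aeval w (pderiv i f) := by
  classical
  induction f using MvPolynomial.induction_on with
  | C a => simp
  | add p q hp hq => simp [hp, hq, mul_add, Finset.sum_add_distrib]
  | mul_X p j hp =>
    simp only [map_mul, aeval_X, Derivation.leibniz, hp, smul_eq_mul, pderiv_X, map_add, mul_add,
      Finset.sum_add_distrib, Finset.mul_sum]
    congr 1
    · rw [Finset.sum_eq_single j]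
      · simp [mul_comm]
      · intro i _ hij
        simp [hij.symm]
      · simp
    · exact Finset.sum_congr rfl fun i _ => by ring

end MvPolynomial


/-! ### Directional derivatives and Euler's relation -/

/-- The derivative of `f` in the direction of the constant vector `v`. -/
def dirDeriv (f : MvPolynomial (Fin 4) ℂ) (v : V4) : MvPolynomial (Fin 4) ℂ :=
  ∑ i, C (v i) * pderiv i f

theorem isHomogeneous_dirDeriv {f : MvPolynomial (Fin 4) ℂ} {n : ℕ} (hf : f.IsHomogeneous n)
    (v : V4) : (dirDeriv f v).IsHomogeneous (n - 1) :=
  IsHomogeneous.sum _ _ _ fun _ _ => hf.pderiv.C_mul _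

theorem aeval_dirDeriv {A : Type*} [CommRing A] [Algebra ℂ A] (f : MvPolynomial (Fin 4) ℂ)
    (v : V4) (w : Fin 4 → A) :
    aeval w (dirDeriv f v) = ∑ i, algebraMap ℂ A (v i) * aeval w (pderiv i f) := by
  simp [dirDeriv]

theorem eval_dirDeriv (f : MvPolynomial (Fin 4) ℂ) (v w : V4) :
    eval w (dirDeriv f v) = ∑ i, v i * eval w (pderiv i f) := by
  simp [dirDeriv]

theorem euler {A : Type*} [CommRing A] [Algebra ℂ A] {f : MvPolynomial (Fin 4) ℂ} {n : ℕ}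
    (hf : f.IsHomogeneous n) (w : Fin 4 → A) :
    ∑ i, w i * aeval w (pderiv i f) = n * aeval w f := by
  have := congrArg (aeval w) hf.sum_X_mul_pderiv
  simpa using this

theorem eval_dirDeriv_self {f : MvPolynomial (Fin 4) ℂ} {n : ℕ} (hf : f.IsHomogeneous n)
    (w : V4) : eval w (dirDeriv f w) = n * eval w f := by
  rw [eval_dirDeriv]
  exact euler hf w

theorem dirDeriv_add (f g : MvPolynomial (Fin 4) ℂ) (v : V4) :
    dirDeriv (f + g) v = dirDeriv f v + dirDeriv g v := by
  simp [dirDeriv, mul_add, Finset.sum_add_distrib]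

theorem dirDeriv_mul (f g : MvPolynomial (Fin 4) ℂ) (v : V4) :
    dirDeriv (f * g) v = f * dirDeriv g v + g * dirDeriv f v := by
  simp only [dirDeriv, Derivation.leibniz, smul_eq_mul, mul_add, Finset.sum_add_distrib,
    Finset.mul_sum]
  congr 1 <;> exact Finset.sum_congr rfl fun i _ => by ring

theorem dirDeriv_add_right (f : MvPolynomial (Fin 4) ℂ) (v w : V4) :
    dirDeriv f (v + w) = dirDeriv f v + dirDeriv f w := by
  simp [dirDeriv, add_mul, Finset.sum_add_distrib]

theorem dirDeriv_smul_right (f : MvPolynomial (Fin 4) ℂ) (c : ℂ) (v : V4) :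
    dirDeriv f (c • v) = C c * dirDeriv f v := by
  simp [dirDeriv, Finset.mul_sum, mul_assoc]

theorem dirDeriv_C (c : ℂ) (v : V4) : dirDeriv (C c) v = 0 := by
  simp [dirDeriv]

theorem dirDeriv_comm (f : MvPolynomial (Fin 4) ℂ) (v w : V4) :
    dirDeriv (dirDeriv f v) w = dirDeriv (dirDeriv f w) v := by
  simp only [dirDeriv, map_sum, pderiv_C_mul, Finset.mul_sum]
  rw [Finset.sum_comm]
  refine Finset.sum_congr rfl fun i _ => Finset.sum_congr rfl fun j _ => ?_
  have h : pderiv j (pderiv i f) = pderiv i (pderiv j f) := by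
    ext m
    simp only [coeff_pderiv]
    by_cases hij : i = j
    · rw [hij]
    · rw [add_right_comm]
      simp [hij, Ne.symm hij]
      ring
  rw [h]
  ring

/-! ### Equations in affine charts -/

/-- The affine chart of `ℂ⁴` with origin `p` and directions `v`, with coordinates in `A`. -/
def chartPoint {A : Type*} [CommRing A] [Algebra ℂ A] (p : V4) (v : Fin 3 → V4) (x : Fin 3 → A) :
    Fin 4 → A :=
  fun i => algebraMap ℂ A (p i) + ∑ j, algebraMap ℂ A (v j i) * x j

theorem localEquation_eq_aeval (f : MvPolynomial (Fin 4) ℂ) (P : P3) (v : Fin 3 → V4) :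
    localEquation f P v = aeval (chartPoint P.rep v X) f := rfl

theorem aeval_localEquation {A : Type*} [CommRing A] [Algebra ℂ A] (f : MvPolynomial (Fin 4) ℂ)
    (P : P3) (v : Fin 3 → V4) (x : Fin 3 → A) :
    aeval x (localEquation f P v) = aeval (chartPoint P.rep v x) f := by
  rw [localEquation, aeval_bind₁]
  congr 2
  funext i
  simp [chartPoint]

theorem pderiv_localEquation (f : MvPolynomial (Fin 4) ℂ) (P : P3) (v : Fin 3 → V4) (j : Fin 3) :
    pderiv j (localEquation f P v) = localEquation (dirDeriv f (v j)) P v := by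
  classical
  rw [localEquation_eq_aeval, localEquation_eq_aeval, derivation_aeval, aeval_dirDeriv]
  refine Finset.sum_congr rfl fun i _ => ?_
  congr 1
  simp [chartPoint, algebraMap_eq, pderiv_X, Pi.single_apply]

theorem constantCoeff_localEquation (f : MvPolynomial (Fin 4) ℂ) (P : P3) (v : Fin 3 → V4) :
    constantCoeff (localEquation f P v) = eval P.rep f := by
  have := aeval_localEquation f P v (0 : Fin 3 → ℂ)
  rw [aeval_eq_eval, aeval_eq_eval] at this
  rw [← eval_zero]
  refine this.trans ?_
  congr 2
  funext i
  simp [chartPoint]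

/-! ### Consequences of the normal form of a type A singularity -/

theorem sumOfPowers_value {R : Type*} [CommRing R] (c : R →+* ℂ)
    {u F : R} {z : Fin 3 → R} {n : ℕ} (hz : ∀ i, c (z i) = 0) (hu : c u ≠ 0)
    (h : u * F = z 0 ^ 2 + z 1 ^ 2 + z 2 ^ (n + 1)) : c F = 0 := by
  have := congrArg c h
  simpa [hz, hu] using this

theorem sumOfPowers_deriv {R : Type*} [CommRing R] [Algebra ℂ R] (c : R →+* ℂ)
    {u F : R} {z : Fin 3 → R} {n : ℕ} (hn : 1 ≤ n) (hz : ∀ i, c (z i) = 0) (hu : c u ≠ 0)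
    (h : u * F = z 0 ^ 2 + z 1 ^ 2 + z 2 ^ (n + 1)) (D : Derivation ℂ R R) : c (D F) = 0 := by
  have hF := sumOfPowers_value c hz hu h
  have := congrArg (fun x => c (D x)) h
  have hn' : n ≠ 0 := by omega
  simpa [hz, hu, hF, Derivation.leibniz, Derivation.leibniz_pow, hn'] using this

/-- Since `n + 1 ≥ 3`, the last power has no second order part. As `F` and its first derivatives
vanish at the origin, the unit contributes only its constant term. -/
theorem sumOfPowers_hessian {R : Type*} [CommRing R] [Algebra ℂ R] (c : R →+* ℂ)
    {u F : R} {z : Fin 3 → R} {n : ℕ} (hn : 2 ≤ n) (hz : ∀ i, c (z i) = 0) (hu : c u ≠ 0)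
    (h : u * F = z 0 ^ 2 + z 1 ^ 2 + z 2 ^ (n + 1)) (D D' : Derivation ℂ R R) :
    c u * c (D (D' F)) = 2 * (c (D (z 0)) * c (D' (z 0)) + c (D (z 1)) * c (D' (z 1))) := by
  have hF := sumOfPowers_value c hz hu h
  have hDF := sumOfPowers_deriv c (by omega) hz hu h
  have := congrArg (fun x => c (D (D' x))) h
  obtain ⟨k, rfl⟩ := Nat.exists_eq_add_of_le hn
  have hk : 2 + k + 1 - 1 = k + 1 + 1 := by omega
  simp [hz, hF, hDF, Derivation.leibniz, Derivation.leibniz_pow, hk, -nsmul_eq_mul] at this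
  rw [this]
  ring

/-- The squared determinant is the Gram determinant, which is minus the square of the off-diagonal
entry when one diagonal entry is zero. -/
theorem not_det_eq_zero_of_gram {b₀ b₁ c₀ c₁ : ℂ} (h₀ : b₀ * b₀ + b₁ * b₁ = 0)
    (h₁ : b₀ * c₀ + b₁ * c₁ ≠ 0) : b₀ * c₁ - b₁ * c₀ ≠ 0 := by
  intro h
  have e₀ : (b₀ * c₀ + b₁ * c₁) * b₀ = 0 := by linear_combination c₀ * h₀ + b₁ * h
  have e₁ : (b₀ * c₀ + b₁ * c₁) * b₁ = 0 := by linear_combination c₁ * h₀ - b₀ * h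
  have f₀ := (mul_eq_zero.1 e₀).resolve_left h₁
  have f₁ := (mul_eq_zero.1 e₁).resolve_left h₁
  exact h₁ (by simp [f₀, f₁])

theorem sum_smul_pderiv_apply (b : Fin 3 → ℂ) (a : MvPowerSeries (Fin 3) ℂ) :
    (∑ j, b j • MvPowerSeries.pderiv ℂ j : Derivation ℂ (MvPowerSeries (Fin 3) ℂ) _) a =
      ∑ j, b j • MvPowerSeries.pderiv ℂ j a := by
  simp [Fin.sum_univ_three]

/-- Along an arc on which the equation of an `A_n`-singularity vanishes to order exactly `m ≤ n`,
its derivatives in two directions spanning a nondegenerate plane cannot vanish to order `m`. -/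
theorem no_low_order_arc {F : MvPolynomial (Fin 3) ℂ} {n m : ℕ} (hn : 2 ≤ n) (hm : 1 ≤ m)
    (hmn : m ≤ n) {z : Fin 3 → MvPowerSeries (Fin 3) ℂ} {u : MvPowerSeries (Fin 3) ℂ}
    (hz : ∀ i, MvPowerSeries.constantCoeff (z i) = 0) (hu : IsUnit u)
    (h : u * (F : MvPowerSeries (Fin 3) ℂ) = z 0 ^ 2 + z 1 ^ 2 + z 2 ^ (n + 1))
    (γ β β' : Fin 3 → PowerSeries ℂ) (hγ : ∀ j, PowerSeries.constantCoeff (γ j) = 0)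
    (hF : PowerSeries.X ^ m ∣ aeval γ F) (hF' : ¬ PowerSeries.X ^ (m + 1) ∣ aeval γ F)
    (hβ : PowerSeries.X ^ m ∣ ∑ j, β j * aeval γ (pderiv j F))
    (hβ' : PowerSeries.X ^ m ∣ ∑ j, β' j * aeval γ (pderiv j F))
    (h₀ : ∑ j, ∑ k, PowerSeries.constantCoeff (β j) * PowerSeries.constantCoeff (β k) *
      constantCoeff (pderiv j (pderiv k F)) = 0)
    (h₁ : ∑ j, ∑ k, PowerSeries.constantCoeff (β j) * PowerSeries.constantCoeff (β' k) *
      constantCoeff (pderiv j (pderiv k F)) ≠ 0) : False := by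
  have hs : MvPowerSeries.HasSubst γ := MvPowerSeries.hasSubst_of_constantCoeff_zero hγ
  let φ : MvPowerSeries (Fin 3) ℂ →ₐ[ℂ] PowerSeries ℂ := MvPowerSeries.substAlgHom hs
  have hφF : ∀ p : MvPolynomial (Fin 3) ℂ, φ (p : MvPowerSeries (Fin 3) ℂ) = aeval γ p :=
    fun p => MvPowerSeries.substAlgHom_coe hs p
  have hφ0 : ∀ a : MvPowerSeries (Fin 3) ℂ, MvPowerSeries.constantCoeff a = 0 →
      PowerSeries.constantCoeff (φ a) = 0 := by
    intro a ha
    change MvPowerSeries.constantCoeff (MvPowerSeries.substAlgHom hs a) = 0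
    rw [MvPowerSeries.substAlgHom_apply]
    exact MvPowerSeries.constantCoeff_subst_eq_zero hs hγ ha
  have hφc : ∀ a : MvPowerSeries (Fin 3) ℂ,
      PowerSeries.constantCoeff (φ a) = MvPowerSeries.constantCoeff a := by
    intro a
    have := hφ0 (a - algebraMap ℂ _ (MvPowerSeries.constantCoeff a)) (by
      simp [MvPowerSeries.algebraMap_apply])
    rw [map_sub, AlgHom.commutes, map_sub, sub_eq_zero] at this
    rw [this]
    simp
  -- Derivative along the arc in a direction that varies with the arc; it satisfies the Leibniz rule
  -- over `φ`.
  let δ : (Fin 3 → PowerSeries ℂ) → MvPowerSeries (Fin 3) ℂ → PowerSeries ℂ :=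
    fun b a => ∑ j, b j * φ (MvPowerSeries.pderiv ℂ j a)
  have δadd : ∀ b a a', δ b (a + a') = δ b a + δ b a' := fun b a a' => by
    simp [δ, mul_add, Finset.sum_add_distrib]
  have δmul : ∀ b a a', δ b (a * a') = φ a * δ b a' + φ a' * δ b a := fun b a a' => by
    simp only [δ, Derivation.leibniz, smul_eq_mul, map_add, map_mul, mul_add,
      Finset.sum_add_distrib, Finset.mul_sum]
    congr 1 <;> exact Finset.sum_congr rfl fun i _ => by ring
  have δpow : ∀ b a (k : ℕ), δ b (a ^ (k + 1)) = ((k + 1 : ℕ) : PowerSeries ℂ) * φ a ^ k * δ b a := by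
    intro b a k
    induction k with
    | zero => simp
    | succ k ih => rw [pow_succ, δmul, ih]; push_cast; rw [map_pow]; ring
  have δF : ∀ b, δ b (F : MvPowerSeries (Fin 3) ℂ) = ∑ j, b j * aeval γ (pderiv j F) := fun b => by
    simp only [δ, MvPowerSeries.pderiv_coe, hφF]
  have hza : ∀ i, (PowerSeries.X : PowerSeries ℂ) ∣ φ (z i) := fun i =>
    PowerSeries.X_dvd_iff.2 ((hφc _).trans (hz i))
  have hzn : (PowerSeries.X : PowerSeries ℂ) ^ m ∣ φ (z 2) ^ n :=
    (pow_dvd_pow _ hmn).trans (pow_dvd_pow_of_dvd (hza 2) n)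
  -- Differentiating the normal form along the arc, every term not involving `z 0` or `z 1` is
  -- divisible by `X ^ m`.
  have hlin : ∀ b, (PowerSeries.X : PowerSeries ℂ) ^ m ∣ ∑ j, b j * aeval γ (pderiv j F) →
      (PowerSeries.X : PowerSeries ℂ) ^ m ∣ 2 * (φ (z 0) * δ b (z 0) + φ (z 1) * δ b (z 1)) := by
    intro b hb
    have e := congrArg (δ b) h
    rw [δmul, δadd, δadd, δpow, δpow, δpow, δF, hφF] at e
    have e' : 2 * (φ (z 0) * δ b (z 0) + φ (z 1) * δ b (z 1)) =
        φ u * (∑ j, b j * aeval γ (pderiv j F)) + aeval γ F * δ b u -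
          φ (z 2) ^ n * (((n + 1 : ℕ) : PowerSeries ℂ) * δ b (z 2)) := by
      push_cast at e ⊢
      linear_combination -e
    rw [e']
    exact dvd_sub (dvd_add (hb.mul_left _) (hF.mul_right _)) (hzn.mul_right _)
  let D : (Fin 3 → PowerSeries ℂ) →
      Derivation ℂ (MvPowerSeries (Fin 3) ℂ) (MvPowerSeries (Fin 3) ℂ) :=
    fun b => ∑ j, PowerSeries.constantCoeff (b j) • MvPowerSeries.pderiv ℂ j
  have hD : ∀ b a, D b a = ∑ j, PowerSeries.constantCoeff (b j) • MvPowerSeries.pderiv ℂ j a :=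
    fun b a => sum_smul_pderiv_apply _ a
  have hδD : ∀ b a, PowerSeries.constantCoeff (δ b a) = MvPowerSeries.constantCoeff (D b a) := by
    intro b a
    simp only [δ, hD, map_sum, map_mul, hφc, MvPowerSeries.smul_eq_C_mul,
      MvPowerSeries.constantCoeff_C]
  have hu' : MvPowerSeries.constantCoeff u ≠ 0 :=
    (MvPowerSeries.isUnit_constantCoeff u hu).ne_zero
  have hDD : ∀ b b', MvPowerSeries.constantCoeff (D b (D b' (F : MvPowerSeries (Fin 3) ℂ))) =
      ∑ j, ∑ k, PowerSeries.constantCoeff (b j) * PowerSeries.constantCoeff (b' k) *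
        constantCoeff (pderiv j (pderiv k F)) := by
    intro b b'
    simp only [hD, map_sum, MvPowerSeries.pderiv_coe, Finset.smul_sum,
      MvPowerSeries.smul_eq_C_mul, map_mul, MvPowerSeries.constantCoeff_C, smul_eq_mul,
      Derivation.leibniz, MvPowerSeries.pderiv_C, mul_zero, add_zero, mul_assoc]
    rfl
  have hess := sumOfPowers_hessian MvPowerSeries.constantCoeff hn hz hu' h
  have g₀ := hess (D β) (D β)
  have g₁ := hess (D β) (D β')
  rw [hDD, h₀, mul_zero] at g₀
  rw [hDD] at g₁
  have hdet := not_det_eq_zero_of_gram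
    (b₀ := MvPowerSeries.constantCoeff (D β (z 0))) (b₁ := MvPowerSeries.constantCoeff (D β (z 1)))
    (c₀ := MvPowerSeries.constantCoeff (D β' (z 0)))
    (c₁ := MvPowerSeries.constantCoeff (D β' (z 1)))
    (by linear_combination -g₀ / 2) (fun h' => by
      rw [h', mul_zero] at g₁
      exact mul_ne_zero hu' h₁ g₁)
  -- The two congruences from `hlin` are a linear system for `φ (z 0)`, `φ (z 1)` with determinant a
  -- unit by `hdet`; Cramer's rule makes both divisible by `X ^ m`.
  set Δ : PowerSeries ℂ := 2 * (δ β (z 0) * δ β' (z 1) - δ β (z 1) * δ β' (z 0)) with hΔ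
  have hunit : IsUnit Δ := by
    rw [PowerSeries.isUnit_iff_constantCoeff, isUnit_iff_ne_zero, hΔ]
    simp only [map_mul, map_sub, hδD, map_ofNat]
    exact mul_ne_zero two_ne_zero hdet
  have k := hlin β hβ
  have k' := hlin β' hβ'
  have z0 : (PowerSeries.X : PowerSeries ℂ) ^ m ∣ φ (z 0) := by
    rw [← hunit.dvd_mul_right]
    have : φ (z 0) * Δ = 2 * (φ (z 0) * δ β (z 0) + φ (z 1) * δ β (z 1)) * δ β' (z 1) -
        2 * (φ (z 0) * δ β' (z 0) + φ (z 1) * δ β' (z 1)) * δ β (z 1) := by rw [hΔ]; ring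
    rw [this]
    exact dvd_sub (k.mul_right _) (k'.mul_right _)
  have z1 : (PowerSeries.X : PowerSeries ℂ) ^ m ∣ φ (z 1) := by
    rw [← hunit.dvd_mul_right]
    have : φ (z 1) * Δ = 2 * (φ (z 0) * δ β' (z 0) + φ (z 1) * δ β' (z 1)) * δ β (z 0) -
        2 * (φ (z 0) * δ β (z 0) + φ (z 1) * δ β (z 1)) * δ β' (z 0) := by rw [hΔ]; ring
    rw [this]
    exact dvd_sub (k'.mul_right _) (k.mul_right _)
  apply hF'
  have e := congrArg φ h
  simp only [map_mul, map_add, map_pow, hφF] at e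
  rw [← (hu.map φ).dvd_mul_left, e]
  -- Squares gain at least one order because `m ≥ 1`, and the last power has order at least `n + 1 ≥
  -- m + 1`.
  have hsq : ∀ a : PowerSeries ℂ, PowerSeries.X ^ m ∣ a → PowerSeries.X ^ (m + 1) ∣ a ^ 2 :=
    fun a ha => (pow_dvd_pow _ (by omega : m + 1 ≤ m * 2)).trans
      (by rw [pow_mul]; exact pow_dvd_pow_of_dvd ha 2)
  exact dvd_add (dvd_add (hsq _ z0) (hsq _ z1))
    ((pow_dvd_pow _ (by omega)).trans (pow_dvd_pow_of_dvd (hza 2) _))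

/-! ### Type A singularities of projective surfaces -/

theorem exists_eq_smul_add_of_linearIndependent {p : V4} {v : Fin 3 → V4}
    (hv : LinearIndependent ℂ (Fin.cons p v : Fin 4 → V4)) :
    ∃ (ℓ : V4 →ₗ[ℂ] ℂ) (κ : Fin 3 → V4 →ₗ[ℂ] ℂ), ∀ e, e = ℓ e • p + ∑ j, κ j e • v j := by
  let b := basisOfLinearIndependentOfCardEqFinrank hv (by simp)
  have hb : ∀ i, b i = (Fin.cons p v : Fin 4 → V4) i := fun i => by simp [b]
  refine ⟨b.coord 0, fun j => b.coord j.succ, fun e => ?_⟩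
  conv_lhs => rw [← b.sum_repr e, Fin.sum_univ_succ]
  simp [hb]

/-- The chart controls three directions; Euler's relation supplies the radial one. -/
theorem IsTypeA.eval_eq_zero {f : MvPolynomial (Fin 4) ℂ} {n d : ℕ} (hf : f.IsHomogeneous d)
    (hn : 1 ≤ n) {Q : P3} (h : IsTypeA n f Q) :
    eval Q.rep f = 0 ∧ ∀ e, eval Q.rep (dirDeriv f e) = 0 := by
  obtain ⟨v, hv, z, u, hz, hu, h⟩ := h
  have hu' : MvPowerSeries.constantCoeff u ≠ 0 :=
    (MvPowerSeries.isUnit_constantCoeff u hu).ne_zero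
  have h₀ := sumOfPowers_value MvPowerSeries.constantCoeff hz.1 hu' h
  have h₁ := fun j => sumOfPowers_deriv MvPowerSeries.constantCoeff hn hz.1 hu' h
    (MvPowerSeries.pderiv ℂ j)
  have k₀ : eval Q.rep f = 0 := (constantCoeff_localEquation f Q v).symm.trans h₀
  have k₁ : ∀ j, eval Q.rep (dirDeriv f (v j)) = 0 := fun j => by
    rw [← constantCoeff_localEquation, ← pderiv_localEquation]
    have := h₁ j
    rw [MvPowerSeries.pderiv_coe] at this
    exact this
  refine ⟨k₀, fun e => ?_⟩
  obtain ⟨ℓ, κ, he⟩ := exists_eq_smul_add_of_linearIndependent hv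
  rw [he e]
  simp only [Fin.sum_univ_three, dirDeriv_add_right, dirDeriv_smul_right, map_add, map_mul, k₁,
    eval_dirDeriv_self hf, k₀]
  simp

/-- A form whose local equation reads `x₂ G + x₁ⁿ⁺¹ U`, with `U` a unit and `G` vanishing at the
origin but not its derivative with respect to `x₀`, has a singularity of type `A_n`. -/
theorem isTypeA_of_localEquation_eq {f : MvPolynomial (Fin 4) ℂ} {Q : P3} {v : Fin 3 → V4} {n : ℕ}
    (hv : LinearIndependent ℂ (Fin.cons Q.rep v : Fin 4 → V4)) {G U : MvPolynomial (Fin 3) ℂ}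
    (h : localEquation f Q v = X 2 * G + X 1 ^ (n + 1) * U) (hU : constantCoeff U ≠ 0)
    (hG : constantCoeff G = 0) (hG' : coeff (Finsupp.single 0 1) G ≠ 0) : IsTypeA n f Q := by
  let U' : MvPowerSeries (Fin 3) ℂ := U
  let w : MvPowerSeries (Fin 3) ℂ := U'⁻¹ * G
  have hU' : MvPowerSeries.constantCoeff U' ≠ 0 := hU
  have hUU : U'⁻¹ * U' = 1 := MvPowerSeries.inv_mul_cancel _ hU'
  have hw : MvPowerSeries.constantCoeff w = 0 := by
    have : MvPowerSeries.constantCoeff (G : MvPowerSeries (Fin 3) ℂ) = 0 := hG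
    simp [w, this]
  have hw' : MvPowerSeries.coeff (Finsupp.single 0 1) w ≠ 0 := by
    have h₀ : MvPowerSeries.constantCoeff (G : MvPowerSeries (Fin 3) ℂ) = 0 := hG
    have e : ∀ a : MvPowerSeries (Fin 3) ℂ, MvPowerSeries.coeff (Finsupp.single 0 1) a =
        MvPowerSeries.constantCoeff (MvPowerSeries.pderiv ℂ 0 a) := fun a => by
      rw [← MvPowerSeries.coeff_zero_eq_constantCoeff_apply, MvPowerSeries.coeff_pderiv]
      simp
    have h₁ : MvPowerSeries.constantCoeff (MvPowerSeries.pderiv ℂ 0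
        (G : MvPowerSeries (Fin 3) ℂ)) ≠ 0 := by
      rw [← e, coeff_coe]; exact hG'
    rw [e]
    simp [w, Derivation.leibniz, h₀, h₁, hU']
  -- After division by `U` the equation is `x₂ w + x₁ⁿ⁺¹`, and `x₂ w = ((x₂ + w)/2)² + (i (x₂ -
  -- w)/2)²`.
  refine ⟨v, hv, ![MvPowerSeries.C (1 / 2) * (MvPowerSeries.X 2 + w),
    MvPowerSeries.C (Complex.I / 2) * (MvPowerSeries.X 2 - w), MvPowerSeries.X 1], U'⁻¹, ⟨?_, ?_⟩,
    ?_, ?_⟩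
  · intro i
    fin_cases i <;> simp [hw]
  · rw [Matrix.det_fin_three]
    simp [MvPowerSeries.coeff_X, Finsupp.single_left_inj]
    intro h₀
    apply hw'
    have h₁ : MvPowerSeries.coeff (Finsupp.single 0 1) w * Complex.I = 0 := by
      linear_combination (-2) * h₀
    exact (mul_eq_zero.1 h₁).resolve_right Complex.I_ne_zero
  · exact IsUnit.of_mul_eq_one _ hUU
  · have hI : (MvPowerSeries.C (Complex.I / 2) : MvPowerSeries (Fin 3) ℂ) ^ 2 =
        - MvPowerSeries.C (1 / 2) ^ 2 := by
      rw [← map_pow, ← map_pow, ← map_neg]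
      congr 1
      rw [div_pow, Complex.I_sq]; ring
    have h4 : (4 : MvPowerSeries (Fin 3) ℂ) * MvPowerSeries.C (1 / 2) ^ 2 = 1 := by
      rw [← map_pow, ← map_ofNat MvPowerSeries.C, ← map_mul, ← map_one MvPowerSeries.C]
      congr 1; norm_num
    rw [h]
    simp only [coe_add, coe_mul, coe_pow, coe_X, Matrix.cons_val_zero, Matrix.cons_val_one,
      Matrix.cons_val]
    change U'⁻¹ * (MvPowerSeries.X 2 * (G : MvPowerSeries (Fin 3) ℂ) +
      MvPowerSeries.X 1 ^ (n + 1) * U') = _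
    have hwG : U'⁻¹ * (G : MvPowerSeries (Fin 3) ℂ) = w := rfl
    linear_combination (MvPowerSeries.X 1 ^ (n + 1)) * hUU + MvPowerSeries.X 2 * hwG
      - (MvPowerSeries.X 2 - w) ^ 2 * hI - MvPowerSeries.X 2 * w * h4

/-! ### Irreducibility -/

/-- Only the two top components can contribute in the top degree. This replaces the factors of a
form by homogeneous ones. -/
theorem MvPolynomial.eq_mul_homogeneousComponent_of_isHomogeneous {σ R : Type*} [CommRing R]
    [IsDomain R] {a b : MvPolynomial σ R} {d : ℕ} (h : (a * b).IsHomogeneous d) (h0 : a * b ≠ 0) :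
    a * b = homogeneousComponent a.totalDegree a * homogeneousComponent b.totalDegree b := by
  have hd : d = a.totalDegree + b.totalDegree := by
    rw [← h.totalDegree h0, totalDegree_mul_of_isDomain (left_ne_zero_of_mul h0)
      (right_ne_zero_of_mul h0)]
  have e := homogeneousComponent_of_mem (m := d) ((mem_homogeneousSubmodule d _).2 h)
  rw [if_pos rfl] at e
  conv_lhs => rw [← e, ← sum_homogeneousComponent a, ← sum_homogeneousComponent b]
  have hterm : ∀ i j, homogeneousComponent d (homogeneousComponent i a * homogeneousComponent j b) =
      if d = i + j then homogeneousComponent i a * homogeneousComponent j b else 0 := fun i j =>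
    homogeneousComponent_of_mem ((mem_homogeneousSubmodule _ _).2
      ((homogeneousComponent_isHomogeneous i a).mul (homogeneousComponent_isHomogeneous j b)))
  rw [Finset.sum_mul_sum, map_sum]
  simp only [map_sum, hterm]
  rw [Finset.sum_eq_single a.totalDegree, Finset.sum_eq_single b.totalDegree, if_pos hd]
  · intro j hj hj'
    rw [if_neg (by rw [Finset.mem_range] at hj; omega)]
  · simp
  · intro i hi hi'
    refine Finset.sum_eq_zero fun j hj => ?_
    rw [if_neg (by rw [Finset.mem_range] at hi hj; omega)]
  · simp

/-- The restriction of `f` to the line through `v` in the direction `p`. -/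
def lineRestrict (f : MvPolynomial (Fin 4) ℂ) (v p : V4) : Polynomial ℂ :=
  aeval (fun i => Polynomial.C (v i) + Polynomial.X * Polynomial.C (p i)) f

theorem eval_lineRestrict (f : MvPolynomial (Fin 4) ℂ) (v p : V4) (c : ℂ) :
    (lineRestrict f v p).eval c = eval (v + c • p) f := by
  rw [lineRestrict, ← Polynomial.coe_aeval_eq_eval, ← AlgHom.comp_apply, comp_aeval,
    aeval_eq_eval]
  congr 2
  funext i
  simp only [map_add, map_mul, Polynomial.aeval_C, Polynomial.aeval_X, Pi.add_apply,
    Pi.smul_apply, smul_eq_mul, Algebra.algebraMap_self, RingHom.id_apply]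

theorem natDegree_C_add_X_mul_C_le (a b : ℂ) :
    (Polynomial.C a + Polynomial.X * Polynomial.C b).natDegree ≤ 1 := by
  rw [add_comm, Polynomial.X_mul_C]
  exact Polynomial.natDegree_linear_le

theorem natDegree_lineRestrict_le {f : MvPolynomial (Fin 4) ℂ} {d : ℕ} (hf : f.IsHomogeneous d)
    (v p : V4) : (lineRestrict f v p).natDegree ≤ d := by
  exact natDegree_aeval_le_of_isHomogeneous hf
    (fun i => Polynomial.C (v i) + Polynomial.X * Polynomial.C (p i))
    (fun i => natDegree_C_add_X_mul_C_le (v i) (p i))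

theorem coeff_lineRestrict {f : MvPolynomial (Fin 4) ℂ} {d : ℕ} (hf : f.IsHomogeneous d)
    (v p : V4) : (lineRestrict f v p).coeff d = eval p f := by
  refine (coeff_aeval_of_isHomogeneous hf
    (fun i => Polynomial.C (v i) + Polynomial.X * Polynomial.C (p i))
    (fun i => natDegree_C_add_X_mul_C_le (v i) (p i))).trans ?_
  rw [aeval_eq_eval]
  congr 2
  funext i
  simp

theorem derivative_lineRestrict (f : MvPolynomial (Fin 4) ℂ) (v p : V4) :
    Polynomial.derivative (lineRestrict f v p) = lineRestrict (dirDeriv f p) v p := by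
  have := derivation_aeval (Polynomial.derivative' (R := ℂ))
    (fun i => Polynomial.C (v i) + Polynomial.X * Polynomial.C (p i)) f
  rw [lineRestrict, lineRestrict, aeval_dirDeriv]
  simpa using this

/-- A hypersurface is irreducible if it has a smooth point `p` and a point `v` outside it such that
its equation is constant along the line through `v` in the direction `p`. -/
theorem irreducible_of_smooth_of_invariant {f : MvPolynomial (Fin 4) ℂ} {d : ℕ}
    (hf : f.IsHomogeneous d) {p v e : V4} (hp : eval p f = 0) (he : eval p (dirDeriv f e) ≠ 0)
    (hv : ∀ c : ℂ, eval (v + c • p) f = eval v f) (hv0 : eval v f ≠ 0) : Irreducible f := by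
  -- On the line the factors multiply to a nonzero constant, so each is constant. A factor of
  -- positive degree then has zero leading coefficient there, which is its value at `p`. Two such
  -- factors would make `p` singular.
  have key : ∀ (A B : MvPolynomial (Fin 4) ℂ) (m n : ℕ), A.IsHomogeneous m → B.IsHomogeneous n →
      f = A * B → m ≠ 0 → eval p A = 0 := by
    intro A B m n hA hB hAB hm
    have hq : lineRestrict A v p * lineRestrict B v p = Polynomial.C (eval v f) := by
      refine Polynomial.funext fun c => ?_
      rw [Polynomial.eval_mul, eval_lineRestrict, eval_lineRestrict, Polynomial.eval_C, ← hv c,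
        hAB, map_mul]
    have hu : IsUnit (lineRestrict A v p) :=
      isUnit_of_mul_isUnit_left (hq ▸ Polynomial.isUnit_C.2 (isUnit_iff_ne_zero.2 hv0))
    rw [← coeff_lineRestrict hA v p]
    exact Polynomial.coeff_eq_zero_of_natDegree_lt
      (by rw [Polynomial.natDegree_eq_zero_of_isUnit hu]; omega)
  have hf0 : f ≠ 0 := by rintro rfl; simp at hv0
  refine ⟨fun hu => ?_, fun {a b} hab => ?_⟩
  · exact (hu.map (eval p)).ne_zero hp
  · have h := eq_mul_homogeneousComponent_of_isHomogeneous (hab ▸ hf) (hab ▸ hf0)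
    have hA := homogeneousComponent_isHomogeneous a.totalDegree a
    have hB := homogeneousComponent_isHomogeneous b.totalDegree b
    have hunit : ∀ g : MvPolynomial (Fin 4) ℂ, g ≠ 0 → g.totalDegree = 0 → IsUnit g := by
      intro g hg hg0
      rw [totalDegree_eq_zero_iff_eq_C] at hg0
      rw [hg0]
      refine IsUnit.map _ (isUnit_iff_ne_zero.2 fun h' => hg ?_)
      rw [hg0, h', C_0]
    by_contra hcon
    rw [not_or] at hcon
    have ha : a ≠ 0 := left_ne_zero_of_mul (hab ▸ hf0)
    have hb : b ≠ 0 := right_ne_zero_of_mul (hab ▸ hf0)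
    have hAp := key _ _ _ _ hA hB (hab.trans h) fun h' => hcon.1 (hunit a ha h')
    have hBp := key _ _ _ _ hB hA (hab.trans (h.trans (mul_comm _ _)))
      fun h' => hcon.2 (hunit b hb h')
    apply he
    rw [hab, h, dirDeriv_mul, map_add, map_mul, map_mul, hAp, hBp]
    simp

/-! ### Formal arcs in a plane -/

/-- Hensel's lemma in `ℂ⟦X⟧`, applied after dividing by the leading coefficient to obtain a monic
polynomial. -/
theorem PowerSeries.exists_root_of_simple_root (g : Polynomial (PowerSeries ℂ)) (n : ℕ)
    (hg : g.natDegree ≤ n) (hgn : IsUnit (g.coeff n)) (a₀ : ℂ)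
    (h₀ : PowerSeries.constantCoeff (g.eval (PowerSeries.C a₀)) = 0)
    (h₁ : PowerSeries.constantCoeff (g.derivative.eval (PowerSeries.C a₀)) ≠ 0) :
    ∃ a : PowerSeries ℂ, g.eval a = 0 ∧ PowerSeries.constantCoeff a = a₀ := by
  obtain ⟨c, hc⟩ := hgn
  have hm : (Polynomial.C (↑c⁻¹ : PowerSeries ℂ) * g).Monic := by
    refine Polynomial.monic_of_natDegree_le_of_coeff_eq_one n
      ((Polynomial.natDegree_C_mul_le _ _).trans hg) ?_
    rw [Polynomial.coeff_C_mul, ← hc, Units.inv_mul]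
  have hI := HenselianRing.is_henselian (I := Ideal.span {(PowerSeries.X : PowerSeries ℂ)}) _ hm
    (PowerSeries.C a₀) ?_ ?_
  · obtain ⟨a, ha, ha'⟩ := hI
    refine ⟨a, ?_, ?_⟩
    · rw [Polynomial.IsRoot, Polynomial.eval_mul, Polynomial.eval_C] at ha
      exact (mul_eq_zero.1 ha).resolve_left (Units.ne_zero _)
    · rw [Ideal.mem_span_singleton, PowerSeries.X_dvd_iff, map_sub, sub_eq_zero] at ha'
      simpa using ha'
  · rw [Polynomial.eval_mul, Ideal.mem_span_singleton, PowerSeries.X_dvd_iff, map_mul, h₀, mul_zero]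
  · refine IsUnit.map _ ?_
    rw [PowerSeries.isUnit_iff_constantCoeff, isUnit_iff_ne_zero, Polynomial.derivative_C_mul,
      Polynomial.eval_mul, map_mul, Polynomial.eval_C]
    exact mul_ne_zero ((PowerSeries.isUnit_iff_constantCoeff.1 (Units.isUnit _)).ne_zero) h₁

/-- The point `q + a e₀ + b e₂` with coordinates in a `ℂ`-algebra. -/
def planePoint {A : Type*} [CommRing A] [Algebra ℂ A] (q e₀ e₂ : V4) (a b : A) : Fin 4 → A :=
  fun i => algebraMap ℂ A (q i) + a * algebraMap ℂ A (e₀ i) + b * algebraMap ℂ A (e₂ i)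

theorem planePoint_eq (q e₀ e₂ : V4) (a b : ℂ) :
    planePoint q e₀ e₂ a b = q + a • e₀ + b • e₂ := by
  funext i; simp [planePoint]

theorem algHom_aeval_planePoint {A B : Type*} [CommRing A] [Algebra ℂ A] [CommRing B] [Algebra ℂ B]
    (φ : A →ₐ[ℂ] B) (q e₀ e₂ : V4) (a b : A) (g : MvPolynomial (Fin 4) ℂ) :
    φ (aeval (planePoint q e₀ e₂ a b) g) = aeval (planePoint q e₀ e₂ (φ a) (φ b)) g := by
  rw [← AlgHom.comp_apply, comp_aeval]
  congr 2
  funext i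
  simp [planePoint]

/-- Equality at all complex points is an identity of polynomials in two variables, so it may be
specialized to any algebra, in particular to a formal arc. -/
theorem aeval_planePoint_congr {A : Type*} [CommRing A] [Algebra ℂ A] {q e₀ e₂ : V4}
    {g : MvPolynomial (Fin 4) ℂ}
    (h : ∀ x y : ℂ, eval (q + x • e₀ + y • e₂) g = eval (q + y • e₂) g) (a b : A) :
    aeval (planePoint q e₀ e₂ a b) g = aeval (planePoint q e₀ e₂ 0 b) g := by
  have : aeval (planePoint q e₀ e₂ (X 0 : MvPolynomial (Fin 2) ℂ) (X 1)) g =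
      aeval (planePoint q e₀ e₂ (0 : MvPolynomial (Fin 2) ℂ) (X 1)) g := by
    refine MvPolynomial.funext fun x => ?_
    have e := fun a b => algHom_aeval_planePoint (aeval x : MvPolynomial (Fin 2) ℂ →ₐ[ℂ] ℂ)
      q e₀ e₂ a b g
    simp only [aeval_eq_eval] at e
    rw [e, e]
    simp only [eval_X, map_zero, planePoint_eq, h, zero_smul, add_zero]
  have := congrArg (aeval ![a, b]) this
  rw [algHom_aeval_planePoint, algHom_aeval_planePoint] at this
  simpa using this

theorem dirDeriv_eval_eq_zero_of_invariant {f : MvPolynomial (Fin 4) ℂ} {v p : V4}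
    (h : ∀ x : ℂ, eval (v + x • p) f = eval v f) (x : ℂ) :
    eval (v + x • p) (dirDeriv f p) = 0 := by
  have : lineRestrict f v p = Polynomial.C (eval v f) :=
    Polynomial.funext fun c => by rw [eval_lineRestrict, h, Polynomial.eval_C]
  rw [← eval_lineRestrict, ← derivative_lineRestrict, this]
  simp

theorem coe_lineRestrict (f : MvPolynomial (Fin 4) ℂ) (q e₀ e₂ : V4) :
    ((lineRestrict f q e₂ : Polynomial ℂ) : PowerSeries ℂ) =
      aeval (planePoint q e₀ e₂ 0 PowerSeries.X) f := by
  have : ∀ p : Polynomial ℂ, (p : PowerSeries ℂ) = Polynomial.coeToPowerSeries.algHom ℂ p := by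
    intro p
    simp [Polynomial.coeToPowerSeries.algHom_apply]
  rw [this, lineRestrict, ← AlgHom.comp_apply, comp_aeval]
  congr 2
  funext i
  rw [← this]
  simp only [planePoint, zero_mul, add_zero, PowerSeries.algebraMap_eq, Polynomial.coe_add,
    Polynomial.coe_mul, Polynomial.coe_X, Polynomial.coe_C]

theorem derivative_aeval {A : Type*} [CommRing A] [Algebra ℂ A] (p : Fin 4 → Polynomial A)
    (g : MvPolynomial (Fin 4) ℂ) : Polynomial.derivative (aeval p g) =
      ∑ i, Polynomial.derivative (p i) * aeval p (pderiv i g) :=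
  derivation_aeval ((Polynomial.derivative' (R := A)).restrictScalars ℂ) p g

theorem constantCoeff_aeval_planePoint (q e₀ e₂ : V4) (p : MvPolynomial (Fin 4) ℂ) :
    PowerSeries.constantCoeff (aeval (planePoint q e₀ e₂ (0 : PowerSeries ℂ) PowerSeries.X) p) =
      eval q p := by
  rw [← coe_lineRestrict, Polynomial.constantCoeff_coe, Polynomial.coeff_zero_eq_eval_zero,
    eval_lineRestrict]
  simp

/-- A point of a surface `g = 0` at which the derivative in the direction `e₀` does not vanish lies
on a formal arc in the surface, contained in a given plane through this direction. -/
theorem exists_arc_of_simple_root {g : MvPolynomial (Fin 4) ℂ} {n : ℕ} (hg : g.IsHomogeneous n)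
    {q e₀ : V4} (hlead : eval e₀ g ≠ 0) (h₀ : eval q g = 0)
    (h₁ : eval q (dirDeriv g e₀) ≠ 0) (e₂ : V4) :
    ∃ α : PowerSeries ℂ, PowerSeries.constantCoeff α = 0 ∧
      aeval (planePoint q e₀ e₂ α PowerSeries.X) g = 0 := by
  -- The `e₀`-coordinate is the unknown, and the `e₂`-coordinate is the arc parameter.
  let pt : Fin 4 → Polynomial (PowerSeries ℂ) :=
    planePoint q e₀ e₂ Polynomial.X (Polynomial.C PowerSeries.X)
  have hptform : ∀ i, pt i = Polynomial.C (PowerSeries.C (e₀ i)) * Polynomial.X +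
      Polynomial.C (PowerSeries.C (q i) + PowerSeries.X * PowerSeries.C (e₂ i)) := fun i => by
    have : ∀ a : ℂ, algebraMap ℂ (Polynomial (PowerSeries ℂ)) a =
      Polynomial.C (PowerSeries.C a) := fun a => rfl
    simp only [pt, planePoint, this, map_add, map_mul]
    ring
  have hpt : ∀ i, (pt i).natDegree ≤ 1 := fun i => by
    rw [hptform]; exact Polynomial.natDegree_linear_le
  have hev : ∀ (p : MvPolynomial (Fin 4) ℂ) (a : PowerSeries ℂ),
      (aeval pt p).eval a = aeval (planePoint q e₀ e₂ a PowerSeries.X) p := fun p a => by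
    have := algHom_aeval_planePoint ((Polynomial.aeval a :
      Polynomial (PowerSeries ℂ) →ₐ[PowerSeries ℂ] PowerSeries ℂ).restrictScalars ℂ)
      q e₀ e₂ Polynomial.X (Polynomial.C PowerSeries.X) p
    simpa using this
  have hconst := constantCoeff_aeval_planePoint q e₀ e₂
  have hder : Polynomial.derivative (aeval pt g) = aeval pt (dirDeriv g e₀) := by
    rw [aeval_dirDeriv, derivative_aeval]
    refine Finset.sum_congr rfl fun i _ => ?_
    congr 1
    rw [hptform, Polynomial.derivative_add, Polynomial.derivative_C, Polynomial.derivative_C_mul,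
      Polynomial.derivative_X, mul_one, add_zero]
    rfl
  have hcoeff : (aeval pt g).coeff n = PowerSeries.C (eval e₀ g) := by
    rw [coeff_aeval_of_isHomogeneous hg pt hpt, ← aeval_eq_eval]
    have : (fun i => (pt i).coeff 1) = fun i => Algebra.ofId ℂ (PowerSeries ℂ) (e₀ i) := by
      funext i
      rw [hptform, Polynomial.coeff_add, Polynomial.coeff_C_mul, Polynomial.coeff_X_one, mul_one,
        Polynomial.coeff_C_of_ne_zero one_ne_zero, add_zero]
      rfl
    rw [this]
    exact (comp_aeval_apply (f := e₀) (Algebra.ofId ℂ (PowerSeries ℂ)) g).symm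
  obtain ⟨α, hα, hα0⟩ := PowerSeries.exists_root_of_simple_root (aeval pt g) n
    (natDegree_aeval_le_of_isHomogeneous hg pt hpt)
    (by rw [hcoeff]; exact (isUnit_iff_ne_zero.2 hlead).map _) 0
    (by rw [map_zero, hev, hconst]; exact h₀)
    (by rw [map_zero, hder, hev, hconst]; exact h₁)
  exact ⟨α, hα0, by rw [← hev]; exact hα⟩

/-! ### The restriction to the tangent plane at a type A singularity -/

/-- Subtracting `l` times the moving point from `e` leaves a combination of the chart directions `v
j`; Euler's relation evaluates the radial part removed. -/
theorem sum_mul_pderiv_localEquation {A : Type*} [CommRing A] [Algebra ℂ A]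
    {f : MvPolynomial (Fin 4) ℂ} {d : ℕ} (hf : f.IsHomogeneous d) (Q : P3) (v : Fin 3 → V4)
    (γ : Fin 3 → A) (e : V4) (l : ℂ) (k : Fin 3 → ℂ) (he : e = l • Q.rep + ∑ j, k j • v j) :
    ∑ j, (algebraMap ℂ A (k j) - algebraMap ℂ A l * γ j) *
        aeval γ (pderiv j (localEquation f Q v)) =
      aeval (chartPoint Q.rep v γ) (dirDeriv f e) -
        algebraMap ℂ A l * (d * aeval (chartPoint Q.rep v γ) f) := by
  rw [← euler hf, aeval_dirDeriv]
  simp only [pderiv_localEquation, aeval_localEquation, aeval_dirDeriv, Finset.mul_sum]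
  rw [Finset.sum_comm, ← Finset.sum_sub_distrib]
  refine Finset.sum_congr rfl fun i _ => ?_
  have : e i = l * Q.rep i + ∑ j, k j * v j i := by
    conv_lhs => rw [he]
    simp
  rw [this]
  simp only [chartPoint, Fin.sum_univ_three, map_add, map_mul]
  ring

/-- Radial components do not matter: by Euler's relation for the first derivatives, a singular point
lies in the kernel of its own Hessian. -/
theorem hessian_localEquation {f : MvPolynomial (Fin 4) ℂ} {d : ℕ} (hf : f.IsHomogeneous d)
    (Q : P3) (v : Fin 3 → V4) (hQ : ∀ e, eval Q.rep (dirDeriv f e) = 0)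
    (e e' : V4) (l l' : ℂ) (k k' : Fin 3 → ℂ)
    (he : e = l • Q.rep + ∑ j, k j • v j) (he' : e' = l' • Q.rep + ∑ j, k' j • v j) :
    ∑ i, ∑ j, k i * k' j * constantCoeff (pderiv i (pderiv j (localEquation f Q v))) =
      eval Q.rep (dirDeriv (dirDeriv f e') e) := by
  have h₁ : ∀ w, eval Q.rep (dirDeriv (dirDeriv f w) Q.rep) = 0 := fun w => by
    rw [eval_dirDeriv_self (isHomogeneous_dirDeriv hf w), hQ, mul_zero]
  have h₂ : ∀ w, eval Q.rep (dirDeriv (dirDeriv f Q.rep) w) = 0 := fun w => by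
    rw [dirDeriv_comm, h₁]
  have hC : ∀ (c : ℂ) (g : MvPolynomial (Fin 4) ℂ) w,
      dirDeriv (C c * g) w = C c * dirDeriv g w := fun c g w => by
    rw [dirDeriv_mul, dirDeriv_C, mul_zero, add_zero]
  rw [he, he']
  simp only [pderiv_localEquation, constantCoeff_localEquation, Fin.sum_univ_three,
    dirDeriv_add_right, dirDeriv_smul_right, dirDeriv_add, hC, map_add, map_mul, eval_C, h₁, h₂]
  ring

/-- Near a singularity `Q` of type `A_{d-1}` of a surface of degree `d`, consider a plane on which
the equation is invariant in the direction `e₀`. Then the equation on the line through `Q` in a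
complementary direction `e₂` is a multiple of the `d`-th power of the coordinate. -/
theorem IsTypeA.lineRestrict_eq {f : MvPolynomial (Fin 4) ℂ} {d : ℕ} (hd : 3 ≤ d)
    (hf : f.IsHomogeneous d) {Q : P3} (hQ : IsTypeA (d - 1) f Q) {e₀ e₂ e₃ : V4}
    (hinv : ∀ x y : ℂ, eval (Q.rep + x • e₀ + y • e₂) f = eval (Q.rep + y • e₂) f)
    (hlead : eval e₀ (dirDeriv f e₃) ≠ 0)
    (hmix : eval Q.rep (dirDeriv (dirDeriv f e₃) e₀) ≠ 0) :
    ∃ c : ℂ, lineRestrict f Q.rep e₂ = Polynomial.C c * Polynomial.X ^ d := by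
  obtain ⟨hQf, hQd⟩ := hQ.eval_eq_zero hf (by omega)
  obtain ⟨v, hv, z, u, hz, hu, h⟩ := hQ
  obtain ⟨ℓ, κ, hdec⟩ := exists_eq_smul_add_of_linearIndependent hv
  set H := lineRestrict f Q.rep e₂ with hH
  have hHd : H.natDegree ≤ d := natDegree_lineRestrict_le hf _ _
  by_cases hH0 : H = 0
  · exact ⟨0, by simp [hH0]⟩
  set m := H.natTrailingDegree with hmdef
  have hmd : m ≤ d := (Polynomial.natTrailingDegree_le_natDegree H).trans hHd
  -- If the order at the origin is `d`, the degree bound leaves only a monomial. A smaller order is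
  -- to be excluded.
  rcases hmd.eq_or_lt with hmd | hmd
  · refine ⟨H.coeff d, Polynomial.ext fun k => ?_⟩
    rw [Polynomial.coeff_C_mul, Polynomial.coeff_X_pow]
    split_ifs with hk
    · rw [hk, mul_one]
    · rw [mul_zero]
      rcases lt_or_gt_of_ne hk with hk | hk
      · exact Polynomial.coeff_eq_zero_of_lt_natTrailingDegree (by omega)
      · exact Polynomial.coeff_eq_zero_of_natDegree_lt (by omega)
  exfalso
  have hm1 : 1 ≤ m := by
    by_contra hm
    have hm0 : m = 0 := by omega
    have : H.coeff m ≠ 0 := by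
      exact Polynomial.trailingCoeff_nonzero_iff_nonzero.2 hH0
    rw [hm0, Polynomial.coeff_zero_eq_eval_zero, hH, eval_lineRestrict] at this
    simp [hQf] at this
  set g := dirDeriv f e₃ with hg
  have hgh : g.IsHomogeneous (d - 1) := isHomogeneous_dirDeriv hf _
  -- On this arc the derivatives along `e₃` and, by invariance, along `e₀` vanish, while `f` equals
  -- `H` there.
  obtain ⟨α, hα0, hα⟩ := exists_arc_of_simple_root hgh hlead (hQd e₃) hmix e₂
  set w : Fin 4 → PowerSeries ℂ := planePoint Q.rep e₀ e₂ α PowerSeries.X with hw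
  have hwf : aeval w f = (H : PowerSeries ℂ) := by
    rw [hw, aeval_planePoint_congr hinv, hH, ← coe_lineRestrict]
  have hinv' : ∀ x y : ℂ, eval (Q.rep + x • e₀ + y • e₂) (dirDeriv f e₀) = 0 := fun x y => by
    have e := dirDeriv_eval_eq_zero_of_invariant (f := f) (v := Q.rep + y • e₂) (p := e₀)
      (fun x => by rw [add_right_comm, hinv]) x
    rwa [add_right_comm]
  have hwe₀ : aeval w (dirDeriv f e₀) = 0 := by
    rw [hw, aeval_planePoint_congr (fun x y => by
      rw [hinv', ← hinv' 0 y]; simp), ← coe_lineRestrict]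
    have : lineRestrict (dirDeriv f e₀) Q.rep e₂ = 0 := Polynomial.funext fun y => by
      rw [eval_lineRestrict]; simpa using hinv' 0 y
    rw [this, Polynomial.coe_zero]
  -- The `Q.rep`-coordinate of the arc; dividing by this unit moves the arc into the affine chart.
  set lam : PowerSeries ℂ :=
    1 + α * PowerSeries.C (ℓ e₀) + PowerSeries.X * PowerSeries.C (ℓ e₂) with hlam
  have hlam0 : PowerSeries.constantCoeff lam = 1 := by simp [hlam, hα0]
  have hlamu : IsUnit lam := by rw [PowerSeries.isUnit_iff_constantCoeff, hlam0]; exact isUnit_one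
  obtain ⟨μ, hμ⟩ := hlamu.exists_left_inv
  let γ : Fin 3 → PowerSeries ℂ := fun j =>
    μ * (α * PowerSeries.C (κ j e₀) + PowerSeries.X * PowerSeries.C (κ j e₂))
  have hγ0 : ∀ j, PowerSeries.constantCoeff (γ j) = 0 := fun j => by simp [γ, hα0]
  have hchart : chartPoint Q.rep v γ = μ • w := by
    funext i
    have h₀ : e₀ i = ℓ e₀ * Q.rep i + ∑ j, κ j e₀ * v j i := by
      conv_lhs => rw [hdec e₀]
      simp
    have h₂ : e₂ i = ℓ e₂ * Q.rep i + ∑ j, κ j e₂ * v j i := by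
      conv_lhs => rw [hdec e₂]
      simp
    simp only [chartPoint, hw, planePoint, Pi.smul_apply, smul_eq_mul, γ, h₀, h₂,
      Fin.sum_univ_three, map_add, map_mul, PowerSeries.algebraMap_eq]
    linear_combination (-PowerSeries.C (Q.rep i)) * hμ
  have hscale : ∀ {p : MvPolynomial (Fin 4) ℂ} {k : ℕ}, p.IsHomogeneous k →
      aeval (chartPoint Q.rep v γ) p = μ ^ k * aeval w p := fun hp => by
    rw [hchart, aeval_smul_of_isHomogeneous hp]
  have hμu : IsUnit (μ ^ d) := (IsUnit.of_mul_eq_one _ hμ).pow d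
  have hFγ : aeval γ (localEquation f Q v) = μ ^ d * (H : PowerSeries ℂ) := by
    rw [aeval_localEquation, hscale hf, hwf]
  have hHm : (PowerSeries.X : PowerSeries ℂ) ^ m ∣ (H : PowerSeries ℂ) := by
    rw [PowerSeries.X_pow_dvd_iff]
    intro k hk
    rw [Polynomial.coeff_coe]
    exact Polynomial.coeff_eq_zero_of_lt_natTrailingDegree hk
  have hHm' : ¬ (PowerSeries.X : PowerSeries ℂ) ^ (m + 1) ∣ (H : PowerSeries ℂ) := by
    rw [PowerSeries.X_pow_dvd_iff]
    intro hk
    have := hk m (by omega)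
    rw [Polynomial.coeff_coe] at this
    exact hH0 (Polynomial.trailingCoeff_eq_zero.1 this)
  let β : V4 → Fin 3 → PowerSeries ℂ := fun e j =>
    algebraMap ℂ _ (κ j e) - algebraMap ℂ _ (ℓ e) * γ j
  have hβ0 : ∀ e j, PowerSeries.constantCoeff (β e j) = κ j e := fun e j => by
    simp [β, hγ0, PowerSeries.algebraMap_eq]
  have hβ : ∀ e, aeval w (dirDeriv f e) = 0 → (PowerSeries.X : PowerSeries ℂ) ^ m ∣
      ∑ j, β e j * aeval γ (pderiv j (localEquation f Q v)) := by
    intro e he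
    rw [sum_mul_pderiv_localEquation hf Q v γ e (ℓ e) (fun j => κ j e) (hdec e),
      hscale (isHomogeneous_dirDeriv hf e), he, hscale hf, hwf, mul_zero, zero_sub]
    exact (((hHm.mul_left _).mul_left _).mul_left _).neg_right
  have hess := fun e e' => hessian_localEquation hf Q v hQd e e' (ℓ e) (ℓ e')
    (fun j => κ j e) (fun j => κ j e') (hdec e) (hdec e')
  refine no_low_order_arc (F := localEquation f Q v) (n := d - 1) (m := m) (by omega) hm1
    (by omega) hz.1 hu h γ (β e₀) (β e₃) hγ0 (by rw [hFγ]; exact hHm.mul_left _)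
    (by rw [hFγ, hμu.dvd_mul_left]; exact hHm') (hβ e₀ hwe₀) (hβ e₃ hα) ?_ ?_
  · simp only [hβ0]
    rw [hess]
    have : lineRestrict (dirDeriv f e₀) Q.rep e₀ = 0 := Polynomial.funext fun x => by
      rw [eval_lineRestrict]; simpa using hinv' x 0
    have h' := derivative_lineRestrict (dirDeriv f e₀) Q.rep e₀
    rw [this, Polynomial.derivative_zero] at h'
    have := eval_lineRestrict (dirDeriv (dirDeriv f e₀) e₀) Q.rep e₀ 0
    rw [← h'] at this
    simpa using this.symm
  · simp only [hβ0]
    rw [hess]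
    exact hmix

/-! ### Counting singular points on a line -/

theorem liesOn_iff {Q : P3} {L : Submodule ℂ V4} : LiesOn Q L ↔ Q.rep ∈ L := by
  rw [LiesOn, Projectivization.submodule_eq, Submodule.span_singleton_le_iff_mem]

theorem mem_tangentSpaceAt {f : MvPolynomial (Fin 4) ℂ} {P : P3} {v : V4} :
    v ∈ tangentSpaceAt f P ↔ eval P.rep (dirDeriv f v) = 0 := by
  rw [tangentSpaceAt, LinearMap.mem_ker, eval_dirDeriv]
  simp [LinearMap.sum_apply, mul_comm]

theorem pderiv_eq_dirDeriv (f : MvPolynomial (Fin 4) ℂ) (i : Fin 4) :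
    pderiv i f = dirDeriv f (Pi.single i 1) := by
  rw [dirDeriv, Finset.sum_eq_single i]
  · simp
  · intro j _ hj
    simp [hj]
  · simp

theorem eval_smul_of_isHomogeneous {f : MvPolynomial (Fin 4) ℂ} {n : ℕ} (hf : f.IsHomogeneous n)
    (c : ℂ) (w : V4) : eval (c • w) f = c ^ n * eval w f :=
  aeval_smul_of_isHomogeneous hf c w

/-- Points of a line with distinct affine coordinates among the roots of a nonzero polynomial are at
most as many as its degree. -/
theorem encard_le_natDegree {S : Set P3} {p e₁ : V4} {q : Polynomial ℂ} (hq : q ≠ 0)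
    (h : ∀ Q ∈ S, ∃ b t : ℂ, b ≠ 0 ∧ Q.rep = b • (e₁ + t • p) ∧ q.IsRoot t) :
    S.encard ≤ q.natDegree := by
  choose! b t hb hQ ht using h
  have hinj : Set.InjOn t S := by
    intro Q hQS Q' hQS' htt
    rw [← Q.mk_rep, ← Q'.mk_rep, Projectivization.mk_eq_mk_iff']
    refine ⟨b Q * (b Q')⁻¹, ?_⟩
    rw [hQ Q hQS, hQ Q' hQS', htt, smul_smul, inv_mul_cancel_right₀ (hb Q' hQS')]
  rw [← hinj.encard_image]
  have hsub : t '' S ⊆ (q.roots.toFinset : Set ℂ) := by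
    rintro _ ⟨Q, hQS, rfl⟩
    simpa [hq] using ht Q hQS
  refine (Set.encard_le_encard hsub).trans ?_
  rw [Set.encard_coe_eq_coe_finsetCard]
  exact_mod_cast (Multiset.toFinset_card_le _).trans (Polynomial.card_roots' q)

/-- Only `p` itself lacks an affine coordinate, and it is excluded because `g` does not vanish
there. -/
theorem exists_affine_coordinate {L : Submodule ℂ V4} {p e₁ : V4}
    (hL : L = Submodule.span ℂ {p, e₁}) {g : MvPolynomial (Fin 4) ℂ} {n : ℕ}
    (hg : g.IsHomogeneous n) (hgp : eval p g ≠ 0) {Q : P3} (hQ : LiesOn Q L)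
    (hgQ : eval Q.rep g = 0) : ∃ b t : ℂ, b ≠ 0 ∧ Q.rep = b • (e₁ + t • p) := by
  rw [liesOn_iff, hL, Submodule.mem_span_pair] at hQ
  obtain ⟨a, b, hab⟩ := hQ
  have hb : b ≠ 0 := by
    rintro rfl
    rw [zero_smul, add_zero] at hab
    rw [← hab, eval_smul_of_isHomogeneous hg] at hgQ
    have ha : a = 0 := by
      have := (mul_eq_zero.1 hgQ).resolve_right hgp
      exact eq_zero_of_pow_eq_zero this
    exact Q.rep_nonzero (by rw [← hab, ha, zero_smul])
  refine ⟨b, a / b, hb, ?_⟩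
  rw [← hab, smul_add, smul_smul, mul_div_cancel₀ _ hb, add_comm]

theorem isRoot_lineRestrict {g : MvPolynomial (Fin 4) ℂ} {n : ℕ} (hg : g.IsHomogeneous n)
    {Q : P3} {p e₁ : V4} {b t : ℂ} (hb : b ≠ 0) (hQ : Q.rep = b • (e₁ + t • p))
    (hgQ : eval Q.rep g = 0) : (lineRestrict g e₁ p).IsRoot t := by
  rw [Polynomial.IsRoot, eval_lineRestrict]
  rw [hQ, eval_smul_of_isHomogeneous hg] at hgQ
  exact (mul_eq_zero.1 hgQ).resolve_left (pow_ne_zero _ hb)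

/-- A surface of degree `d` with `d - 1` singular points on a line contains the line, if it contains
another point of it. -/
theorem eval_eq_zero_of_singular {f : MvPolynomial (Fin 4) ℂ} {d : ℕ} (hd : 2 ≤ d)
    (hf : f.IsHomogeneous d) {p e₁ : V4} (hp : eval p f = 0) {S : Set P3}
    (hcard : ((d - 1 : ℕ) : ℕ∞) ≤ S.encard)
    (hS : ∀ Q ∈ S, ∃ b t : ℂ, b ≠ 0 ∧ Q.rep = b • (e₁ + t • p))
    (hsing : ∀ Q ∈ S, eval Q.rep f = 0 ∧ ∀ e, eval Q.rep (dirDeriv f e) = 0) (t : ℂ) :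
    eval (e₁ + t • p) f = 0 := by
  set k := lineRestrict f e₁ p with hk
  have hkd : k.natDegree ≤ d - 1 := by
    rw [Polynomial.natDegree_le_iff_coeff_eq_zero]
    intro N hN
    rcases (show d ≤ N by omega).eq_or_lt with rfl | hN
    · rw [hk, coeff_lineRestrict hf, hp]
    · exact Polynomial.coeff_eq_zero_of_natDegree_lt
        ((natDegree_lineRestrict_le hf e₁ p).trans_lt hN)
  -- The derivative has degree at most `d - 2`, since the leading coefficient is the value at `p`,
  -- but it has `d - 1` roots.
  have hk' : Polynomial.derivative k = 0 := by
    by_contra h0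
    have h1 := encard_le_natDegree (S := S) (p := p) (e₁ := e₁) h0 fun Q hQ => by
      obtain ⟨b, t, hb, hbt⟩ := hS Q hQ
      refine ⟨b, t, hb, hbt, ?_⟩
      rw [hk, derivative_lineRestrict]
      exact isRoot_lineRestrict (isHomogeneous_dirDeriv hf p) hb hbt ((hsing Q hQ).2 p)
    have h2 := hcard.trans h1
    have h3 : d - 1 ≤ (Polynomial.derivative k).natDegree := by exact_mod_cast h2
    have h4 := Polynomial.natDegree_derivative_le k
    omega
  obtain ⟨Q, hQ⟩ : S.Nonempty := by
    rw [← Set.encard_pos]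
    refine lt_of_lt_of_le ?_ hcard
    exact_mod_cast (by omega : 0 < d - 1)
  obtain ⟨b, t', hb, hbt⟩ := hS Q hQ
  have h1 := isRoot_lineRestrict hf hb hbt (hsing Q hQ).1
  have h2 := Polynomial.eq_C_of_derivative_eq_zero hk'
  rw [← hk, h2, Polynomial.IsRoot, Polynomial.eval_C] at h1
  rw [← eval_lineRestrict, ← hk, h2, h1]
  simp

/-- A line in the surface lies in the tangent space at each of its points; here the line is
reparametrized so that `p` is the origin. -/
theorem dirDeriv_eval_eq_zero_of_line {f : MvPolynomial (Fin 4) ℂ} {d : ℕ}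
    (hf : f.IsHomogeneous d) {p e₁ : V4} (hp : eval p f = 0)
    (h : ∀ t : ℂ, eval (e₁ + t • p) f = 0) : eval p (dirDeriv f e₁) = 0 := by
  have h0 : lineRestrict f p e₁ = 0 := by
    refine Polynomial.funext fun c => ?_
    rw [eval_lineRestrict, Polynomial.eval_zero]
    by_cases hc : c = 0
    · simp [hc, hp]
    · have : p + c • e₁ = c • (e₁ + c⁻¹ • p) := by
        rw [smul_add, smul_smul, mul_inv_cancel₀ hc, one_smul, add_comm]
      rw [this, eval_smul_of_isHomogeneous hf, h, mul_zero]
  have h1 := derivative_lineRestrict f p e₁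
  rw [h0, Polynomial.derivative_zero] at h1
  have h2 := eval_lineRestrict (dirDeriv f e₁) p e₁ 0
  rw [← h1] at h2
  simpa using h2.symm

/-- A form of degree `n` on a line with `n` distinct zeros has simple zeros. -/
theorem dirDeriv_ne_zero_of_encard {g : MvPolynomial (Fin 4) ℂ} {n : ℕ}
    (hg : g.IsHomogeneous n) {p e₁ : V4} (hgp : eval p g ≠ 0) {S : Set P3}
    (hcard : (n : ℕ∞) ≤ S.encard)
    (hS : ∀ Q ∈ S, ∃ b t : ℂ, b ≠ 0 ∧ Q.rep = b • (e₁ + t • p))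
    (hzero : ∀ Q ∈ S, eval Q.rep g = 0) {Q : P3} (hQ : Q ∈ S) :
    eval Q.rep (dirDeriv g p) ≠ 0 := by
  intro hcon
  set r := lineRestrict g e₁ p with hr
  have hrn : r.natDegree ≤ n := natDegree_lineRestrict_le hg _ _
  have hr0 : r ≠ 0 := by
    intro h0
    apply hgp
    rw [← coeff_lineRestrict hg e₁ p, ← hr, h0, Polynomial.coeff_zero]
  obtain ⟨b, t, hb, hbt⟩ := hS Q hQ
  have h1 := isRoot_lineRestrict hg hb hbt (hzero Q hQ)
  have h2 := isRoot_lineRestrict (isHomogeneous_dirDeriv hg p) hb hbt hcon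
  rw [← derivative_lineRestrict, ← hr] at h2
  rw [← hr] at h1
  have hmul := (Polynomial.one_lt_rootMultiplicity_iff_isRoot hr0).2 ⟨h1, h2⟩
  have hdvd : (Polynomial.X - Polynomial.C t) ^ 2 ∣ r :=
    (pow_dvd_pow _ hmul).trans (Polynomial.pow_rootMultiplicity_dvd r t)
  -- Removing one copy of the double factor keeps all the roots but lowers the degree below their
  -- number.
  obtain ⟨q, hq⟩ := hdvd
  have hq0 : (Polynomial.X - Polynomial.C t) * q ≠ 0 := by
    intro h0
    apply hr0
    rw [hq, pow_two, mul_assoc, h0, mul_zero]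
  have hle := encard_le_natDegree (S := S) (p := p) (e₁ := e₁) hq0 fun Q hQ => by
    obtain ⟨b, t', hb, hbt⟩ := hS Q hQ
    refine ⟨b, t', hb, hbt, ?_⟩
    have h3 := isRoot_lineRestrict hg hb hbt (hzero Q hQ)
    rw [← hr, hq, pow_two, mul_assoc] at h3
    rw [Polynomial.IsRoot, Polynomial.eval_mul] at h3 ⊢
    rcases mul_eq_zero.1 h3 with h4 | h4
    · rw [h4, zero_mul]
    · rwa [Polynomial.eval_mul] at h4
  have h5 : n ≤ ((Polynomial.X - Polynomial.C t) * q).natDegree := by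
    exact_mod_cast hcard.trans hle
  have h6 : r.natDegree = 1 + ((Polynomial.X - Polynomial.C t) * q).natDegree := by
    rw [hq, pow_two, mul_assoc, Polynomial.natDegree_mul (Polynomial.X_sub_C_ne_zero t) hq0,
      Polynomial.natDegree_X_sub_C]
  omega

/-! ### Adapted coordinates and the perturbing form -/

/-- A basis of `ℂ⁴` adapted to a flag, with a given first vector. -/
theorem exists_adapted_basis {L T : Submodule ℂ V4} {p e₁ : V4}
    (hL : L = Submodule.span ℂ {p, e₁}) (hL2 : Module.finrank ℂ L = 2) (hLT : L ≤ T)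
    (hT : Module.finrank ℂ T = 3) :
    ∃ b : Module.Basis (Fin 4) ℂ V4, b 0 = p ∧ b 1 = e₁ ∧ b 2 ∈ T ∧ b 3 ∉ T := by
  obtain ⟨e₂, he₂, he₂'⟩ : ∃ e ∈ T, e ∉ L := by
    by_contra! h
    have : L = T := le_antisymm hLT h
    rw [this, hT] at hL2
    omega
  obtain ⟨e₃, -, he₃⟩ : ∃ e ∈ (⊤ : Submodule ℂ V4), e ∉ T := by
    by_contra! h
    have : T = ⊤ := top_le_iff.1 h
    rw [this, finrank_top] at hT
    simp at hT
  have hrange : Set.range ![e₁, p] = {p, e₁} := by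
    ext x
    simp [eq_comm]
  have h1 : LinearIndependent ℂ ![e₁, p] := by
    rw [linearIndependent_iff_card_eq_finrank_span, Set.finrank, hrange, ← hL, hL2]
    simp
  have h2 : LinearIndependent ℂ ![e₂, e₁, p] := by
    refine linearIndependent_finCons.2 ⟨h1, ?_⟩
    rwa [hrange, ← hL]
  have h3 : LinearIndependent ℂ ![e₃, e₂, e₁, p] := by
    refine linearIndependent_finCons.2 ⟨h2, fun h => he₃ ?_⟩
    refine (Submodule.span_le.2 ?_) h
    rintro _ ⟨i, rfl⟩
    fin_cases i
    · exact he₂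
    · exact hLT (hL ▸ Submodule.subset_span (by simp))
    · exact hLT (hL ▸ Submodule.subset_span (by simp))
  let b := (basisOfLinearIndependentOfCardEqFinrank h3 (by simp)).reindex Fin.revPerm
  have hb : ∀ i, b i = ![e₃, e₂, e₁, p] (Fin.rev i) := fun i => by simp [b]
  exact ⟨b, by rw [hb]; rfl, by rw [hb]; rfl, by rw [hb]; exact he₂, by rw [hb]; exact he₃⟩

/-- The linear form on `ℂ⁴` as a polynomial. -/
def linearPoly (ξ : V4 →ₗ[ℂ] ℂ) : MvPolynomial (Fin 4) ℂ :=
  ∑ i, C (ξ (Pi.single i 1)) * X i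

theorem eval_linearPoly (ξ : V4 →ₗ[ℂ] ℂ) (w : V4) : eval w (linearPoly ξ) = ξ w := by
  rw [← LinearMap.sum_single_apply (fun _ => ℂ) w, map_sum]
  simp only [linearPoly, map_sum, map_mul, eval_C, eval_X]
  refine Finset.sum_congr rfl fun i _ => ?_
  have : (Pi.single i (w i) : V4) = w i • Pi.single i 1 := by
    rw [← Pi.single_smul, smul_eq_mul, mul_one]
  rw [this, map_smul, smul_eq_mul, mul_comm]
  simp [Finset.sum_apply, Pi.single_apply]

theorem isHomogeneous_linearPoly (ξ : V4 →ₗ[ℂ] ℂ) : (linearPoly ξ).IsHomogeneous 1 :=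
  IsHomogeneous.sum _ _ _ fun _ _ => isHomogeneous_C_mul_X _ _

theorem dirDeriv_linearPoly (ξ : V4 →ₗ[ℂ] ℂ) (v : V4) : dirDeriv (linearPoly ξ) v = C (ξ v) := by
  rw [← eval_linearPoly, dirDeriv, linearPoly]
  simp only [map_sum, pderiv_C_mul, pderiv_X, map_mul, eval_C, eval_X]
  refine Finset.sum_congr rfl fun i _ => ?_
  rw [Finset.sum_eq_single i]
  · simp [mul_comm]
  · intro j _ hj
    simp [hj]
  · simp

theorem dirDeriv_pow (f : MvPolynomial (Fin 4) ℂ) (n : ℕ) (v : V4) :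
    dirDeriv (f ^ (n + 1)) v = C ((n + 1 : ℕ) : ℂ) * f ^ n * dirDeriv f v := by
  induction n with
  | zero => simp
  | succ n ih => rw [pow_succ, dirDeriv_mul, ih]; push_cast; simp only [map_add, map_one]; ring

/-- The form `ξ₂ᵏ ξ₁`. -/
def perturbation (ξ₁ ξ₂ : V4 →ₗ[ℂ] ℂ) (k : ℕ) : MvPolynomial (Fin 4) ℂ :=
  linearPoly ξ₂ ^ k * linearPoly ξ₁

theorem isHomogeneous_perturbation (ξ₁ ξ₂ : V4 →ₗ[ℂ] ℂ) (k : ℕ) :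
    (perturbation ξ₁ ξ₂ k).IsHomogeneous (k + 1) := by
  have := ((isHomogeneous_linearPoly ξ₂).pow k).mul (isHomogeneous_linearPoly ξ₁)
  rwa [one_mul] at this

theorem eval_perturbation (ξ₁ ξ₂ : V4 →ₗ[ℂ] ℂ) (k : ℕ) (w : V4) :
    eval w (perturbation ξ₁ ξ₂ k) = ξ₂ w ^ k * ξ₁ w := by
  rw [perturbation, map_mul, map_pow, eval_linearPoly, eval_linearPoly]

theorem dirDeriv_perturbation_eq_zero {ξ₁ ξ₂ : V4 →ₗ[ℂ] ℂ} (k : ℕ) {e : V4} (h₁ : ξ₁ e = 0)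
    (h₂ : ξ₂ e = 0) : dirDeriv (perturbation ξ₁ ξ₂ (k + 1)) e = 0 := by
  rw [perturbation, dirDeriv_mul, dirDeriv_pow, dirDeriv_linearPoly, dirDeriv_linearPoly, h₁, h₂]
  simp

theorem eval_dirDeriv_perturbation {ξ₁ ξ₂ : V4 →ₗ[ℂ] ℂ} (k : ℕ) {w : V4} (h : ξ₂ w = 0) (e : V4) :
    eval w (dirDeriv (perturbation ξ₁ ξ₂ (k + 2)) e) = 0 := by
  rw [perturbation, dirDeriv_mul, dirDeriv_pow, map_add, map_mul, map_mul, map_mul, map_mul,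
    map_pow, map_pow, eval_linearPoly ξ₂, h]
  simp

/-! ### Recognizing type A from a plane section -/

/-- Setting the last variable to zero does not change the class modulo `X 2`, and here the result is
the zero polynomial. -/
theorem X_two_dvd_of_eval_eq_zero {p : MvPolynomial (Fin 3) ℂ}
    (h : ∀ x y : ℂ, eval ![x, y, 0] p = 0) : X 2 ∣ p := by
  have h0 : aeval (![X 0, X 1, 0] : Fin 3 → MvPolynomial (Fin 3) ℂ) p = 0 := by
    refine MvPolynomial.funext fun x => ?_
    have := comp_aeval_apply (f := (![X 0, X 1, 0] : Fin 3 → MvPolynomial (Fin 3) ℂ))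
      (aeval x : MvPolynomial (Fin 3) ℂ →ₐ[ℂ] ℂ) p
    simp only [aeval_eq_eval] at this
    rw [this, map_zero, ← h (x 0) (x 1)]
    congr 2
    funext i
    fin_cases i <;> simp
  have key : (Ideal.Quotient.mkₐ ℂ (Ideal.span {(X 2 : MvPolynomial (Fin 3) ℂ)})).comp
      (aeval (![X 0, X 1, 0] : Fin 3 → MvPolynomial (Fin 3) ℂ)) =
      Ideal.Quotient.mkₐ ℂ (Ideal.span {(X 2 : MvPolynomial (Fin 3) ℂ)}) := by
    refine MvPolynomial.algHom_ext fun i => ?_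
    fin_cases i
    · simp
    · simp
    · simp only [Fin.reduceFinMk, AlgHom.comp_apply, aeval_X, Matrix.cons_val, map_zero]
      exact (Ideal.Quotient.eq_zero_iff_mem.2 (Ideal.mem_span_singleton_self _)).symm
  have := DFunLike.congr_fun key p
  rw [AlgHom.comp_apply, h0, map_zero] at this
  exact Ideal.mem_span_singleton.1 (Ideal.Quotient.eq_zero_iff_mem.1 this.symm)

theorem eval_localEquation (f : MvPolynomial (Fin 4) ℂ) (Q : P3) (v : Fin 3 → V4) (x : Fin 3 → ℂ) :
    eval x (localEquation f Q v) = eval (Q.rep + ∑ j, x j • v j) f := by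
  refine (aeval_localEquation f Q v x).trans ?_
  rw [aeval_eq_eval]
  congr 2
  funext i
  simp [chartPoint, mul_comm]

/-- A surface whose equation on the plane through a singular point `Q` spanned by `e₀, e₂` is
`yⁿ⁺¹ (a y + b)` with `b ≠ 0` has a singularity of type `A_n` at `Q`, provided that the derivative
in a transversal direction `e₃` has a simple zero along `e₀`. -/
theorem isTypeA_of_eval_plane {f : MvPolynomial (Fin 4) ℂ} {Q : P3} {e₀ e₂ e₃ : V4} {n : ℕ}
    (hv : LinearIndependent ℂ (Fin.cons Q.rep ![e₀, e₂, e₃] : Fin 4 → V4)) {a b : ℂ} (hb : b ≠ 0)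
    (h : ∀ x y : ℂ, eval (Q.rep + x • e₀ + y • e₂) f = y ^ (n + 1) * (a * y + b))
    (h₃ : eval Q.rep (dirDeriv f e₃) = 0) (h₀₃ : eval Q.rep (dirDeriv (dirDeriv f e₃) e₀) ≠ 0) :
    IsTypeA n f Q := by
  set F := localEquation f Q ![e₀, e₂, e₃] with hF
  let U : MvPolynomial (Fin 3) ℂ := C a * X 1 + C b
  obtain ⟨G, hG⟩ : X 2 ∣ F - X 1 ^ (n + 1) * U := by
    refine X_two_dvd_of_eval_eq_zero fun x y => ?_
    rw [map_sub, hF, eval_localEquation]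
    have : Q.rep + ∑ j, ![x, y, 0] j • ![e₀, e₂, e₃] j = Q.rep + x • e₀ + y • e₂ := by
      simp [Fin.sum_univ_three, add_assoc]
    rw [this, h]
    simp [U]
  have hd : pderiv 2 F = G + X 2 * pderiv 2 G := by
    have e := congrArg (pderiv 2) hG
    have hXU : pderiv 2 (X 1 ^ (n + 1) * U) = 0 := by
      simp [U, Derivation.leibniz, Derivation.leibniz_pow, pderiv_X]
    rw [map_sub, hXU, sub_zero] at e
    rw [e, Derivation.leibniz, pderiv_X_self]
    simp [add_comm]
  have hd' : constantCoeff (pderiv 2 F) = eval Q.rep (dirDeriv f e₃) := by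
    rw [hF, pderiv_localEquation, constantCoeff_localEquation]; rfl
  have hd'' : constantCoeff (pderiv 0 (pderiv 2 F)) =
      eval Q.rep (dirDeriv (dirDeriv f e₃) e₀) := by
    rw [hF, pderiv_localEquation, pderiv_localEquation, constantCoeff_localEquation]; rfl
  refine isTypeA_of_localEquation_eq hv (G := G) (U := U) (by rw [← hG, ← hF]; ring) ?_ ?_ ?_
  · simpa [U] using hb
  · rw [hd, h₃] at hd'
    simpa using hd'
  · have h1 : coeff (Finsupp.single 0 1) G = constantCoeff (pderiv 0 G) := by
      rw [constantCoeff_eq, coeff_pderiv]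
      simp
    rw [h1]
    rw [hd] at hd''
    intro h2
    apply h₀₃
    rw [← hd'']
    simp [h2, Derivation.leibniz, pderiv_X]

/-! ### The family and the main theorem -/

theorem finrank_tangentSpaceAt {f : MvPolynomial (Fin 4) ℂ} {P : P3} (h : IsSmoothPoint f P) :
    Module.finrank ℂ (tangentSpaceAt f P) = 3 := by
  obtain ⟨i, hi⟩ := h.2
  have hne : (∑ i, eval P.rep (pderiv i f) • (LinearMap.proj i : V4 →ₗ[ℂ] ℂ)) ≠ 0 := by
    intro h0
    have := LinearMap.congr_fun h0 (Pi.single i 1)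
    apply hi
    simpa [LinearMap.sum_apply, Pi.single_apply] using this
  have := Module.Dual.finrank_ker_add_one_of_ne_zero hne
  rw [tangentSpaceAt]
  simp at this
  omega

theorem exists_span_pair {L : Submodule ℂ V4} (hL : Module.finrank ℂ L = 2) {p : V4} (hp : p ∈ L)
    (hp0 : p ≠ 0) : ∃ e, L = Submodule.span ℂ {p, e} := by
  obtain ⟨e, he, he'⟩ : ∃ e ∈ L, e ∉ Submodule.span ℂ {p} := by
    by_contra! h
    have h1 : L ≤ Submodule.span ℂ {p} := h
    have h2 := Submodule.finrank_mono h1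
    rw [finrank_span_singleton hp0] at h2
    omega
  refine ⟨e, (Submodule.eq_of_le_of_finrank_eq ?_ ?_).symm⟩
  · rw [Submodule.span_le]
    rintro x (rfl | rfl)
    · exact hp
    · exact he
  · rw [hL]
    have h1 : LinearIndependent ℂ ![e, p] := by
      refine linearIndependent_finCons.2 ⟨?_, ?_⟩
      · exact LinearIndependent.of_subsingleton 0 hp0
      · simpa using he'
    have h2 := linearIndependent_iff_card_eq_finrank_span.1 h1
    have hrange : Set.range ![e, p] = {p, e} := by
      ext x
      simp [eq_comm]
    rw [Set.finrank, hrange] at h2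
    simpa using h2.symm

theorem map_evalRingHom_add_mul (f ψ : MvPolynomial (Fin 4) ℂ) (t : ℂ) :
    map (Polynomial.evalRingHom t) (map Polynomial.C f + C Polynomial.X * map Polynomial.C ψ) =
      f + C t * ψ := by
  have hcomp : (Polynomial.evalRingHom t).comp Polynomial.C = RingHom.id ℂ := by
    ext; simp
  simp only [map_add, map_mul, map_map, hcomp, map_C, Polynomial.coe_evalRingHom,
    Polynomial.eval_X]
  rw [MvPolynomial.map_id, MvPolynomial.map_id]

/-- The family of surfaces `f + t ψ` with a constant line and a constant point. -/
def constantTripleFamily {d : ℕ} (f ψ : MvPolynomial (Fin 4) ℂ) (hf : f.IsHomogeneous d)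
    (hψ : ψ.IsHomogeneous d) (h : ∀ t : ℂ, f + C t * ψ ≠ 0) {p e : V4}
    (hpe : LinearIndependent ℂ ![p, e]) : TripleFamily d where
  form := map Polynomial.C f + C Polynomial.X * map Polynomial.C ψ
  isHomogeneous := (hf.map _).add ((hψ.map _).C_mul _)
  form_ne_zero t := by
    rw [map_evalRingHom_add_mul]
    exact h t
  lineVec k i := Polynomial.C (![p, e] k i)
  line_indep t := by
    simp only [Polynomial.eval_C]
    exact hpe
  pointVec i := Polynomial.C (p i)
  point_ne_zero t := by simpa using hpe.ne_zero 0

theorem constantTripleFamily_X {d : ℕ} {f ψ : MvPolynomial (Fin 4) ℂ} (hf : f.IsHomogeneous d)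
    (hψ : ψ.IsHomogeneous d) (h : ∀ t : ℂ, f + C t * ψ ≠ 0) {p e : V4}
    (hpe : LinearIndependent ℂ ![p, e]) (t : ℂ) :
    (constantTripleFamily f ψ hf hψ h hpe).X t = f + C t * ψ := by
  exact map_evalRingHom_add_mul f ψ t

theorem constantTripleFamily_line {d : ℕ} {f ψ : MvPolynomial (Fin 4) ℂ} (hf : f.IsHomogeneous d)
    (hψ : ψ.IsHomogeneous d) (h : ∀ t : ℂ, f + C t * ψ ≠ 0) {p e : V4}
    (hpe : LinearIndependent ℂ ![p, e]) (t : ℂ) :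
    (constantTripleFamily f ψ hf hψ h hpe).line t = Submodule.span ℂ {p, e} := by
  have hrange : Set.range ![p, e] = {p, e} := by
    ext x
    simp [eq_comm, or_comm]
  simp only [TripleFamily.line, constantTripleFamily, Polynomial.eval_C]
  rw [← hrange]

theorem constantTripleFamily_point {d : ℕ} {f ψ : MvPolynomial (Fin 4) ℂ} (hf : f.IsHomogeneous d)
    (hψ : ψ.IsHomogeneous d) (h : ∀ t : ℂ, f + C t * ψ ≠ 0) {p e : V4}
    (hpe : LinearIndependent ℂ ![p, e]) (t : ℂ) :
    (constantTripleFamily f ψ hf hψ h hpe).point t = Projectivization.mk ℂ p (hpe.ne_zero 0) := by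
  simp [TripleFamily.point, constantTripleFamily]

/-- Adding a form singular along the line and invariant in the direction `P` does not affect the
property of `P` being a smooth star point. -/
theorem IsSmoothStarPoint.add {f ψ : MvPolynomial (Fin 4) ℂ} {P : P3}
    (hP : IsSmoothStarPoint f P) (h₀ : eval P.rep ψ = 0)
    (h₁ : ∀ e, eval P.rep (dirDeriv ψ e) = 0)
    (h₂ : ∀ v (c : ℂ), eval (v + c • P.rep) ψ = eval v ψ) : IsSmoothStarPoint (f + ψ) P := by
  have hgrad : ∀ i, eval P.rep (pderiv i (f + ψ)) = eval P.rep (pderiv i f) := fun i => by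
    rw [map_add, map_add, pderiv_eq_dirDeriv ψ, h₁, add_zero]
  have hT : tangentSpaceAt (f + ψ) P = tangentSpaceAt f P := by
    simp only [tangentSpaceAt, hgrad]
  refine ⟨⟨by rw [map_add, hP.1.1, h₀, add_zero], ?_⟩, ?_⟩
  · simp only [hgrad]
    exact hP.1.2
  · rw [hT]
    refine ⟨hP.2.1, fun v hv c => ?_⟩
    rw [map_add, map_add, hP.2.2 v hv c, h₂]

theorem mainTheorem9 (d : ℕ) (hd : 3 ≤ d)
    (f : MvPolynomial (Fin 4) ℂ) (hf : f.IsHomogeneous d)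
    (L : Submodule ℂ V4) (hL : Module.finrank ℂ L = 2)
    (hLsing : ¬ ∀ Q : P3, LiesOn Q L → IsSingularPoint f Q)
    (hA : ((d - 1 : ℕ) : ℕ∞) ≤ (typeAOn (d - 1) f L).encard)
    (P : P3) (hPL : LiesOn P L) (hP : IsSmoothStarPoint f P) :
    ∃ F : TripleFamily d,
      F.X 0 = f ∧ F.line 0 = L ∧ F.point 0 = P ∧
      ∀ t : ℂ, t ≠ 0 →
        Irreducible (F.X t) ∧
        (typeAOn (d - 2) (F.X t) (F.line t)).encard = ((d - 1 : ℕ) : ℕ∞) ∧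
        LiesOn (F.point t) (F.line t) ∧
        IsSmoothStarPoint (F.X t) (F.point t) := by
  set S := typeAOn (d - 1) f L with hSdef
  set T := tangentSpaceAt f P with hTdef
  have hp0 := P.rep_nonzero
  have hPL' := liesOn_iff.1 hPL
  obtain ⟨e₁, hLspan⟩ := exists_span_pair hL hPL' hp0
  have hpf : eval P.rep f = 0 := hP.1.1
  have hsing : ∀ Q ∈ S, eval Q.rep f = 0 ∧ ∀ e, eval Q.rep (dirDeriv f e) = 0 :=
    fun Q hQ => hQ.2.eval_eq_zero hf (by omega)
  have hT3 := finrank_tangentSpaceAt hP.1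
  obtain ⟨i, hi⟩ := hP.1.2
  have hS : ∀ Q ∈ S, ∃ b t : ℂ, b ≠ 0 ∧ Q.rep = b • (e₁ + t • P.rep) := fun Q hQ =>
    exists_affine_coordinate hLspan hf.pderiv hi hQ.1
      (by rw [pderiv_eq_dirDeriv]; exact (hsing Q hQ).2 _)
  have hline := eval_eq_zero_of_singular (by omega) hf hpf hA hS hsing
  have hpT : P.rep ∈ T := liesOn_iff.1 hP.2.1
  have hLT : L ≤ T := by
    rw [hLspan, Submodule.span_le]
    rintro x (rfl | rfl)
    · exact hpT
    · exact mem_tangentSpaceAt.2 (dirDeriv_eval_eq_zero_of_line hf hpf hline)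
  obtain ⟨b, hb0, hb1, hb2, hb3⟩ := exists_adapted_basis hLspan hL hLT hT3
  set e₂ := b 2 with he₂
  set e₃ := b 3 with he₃
  have hlead : eval P.rep (dirDeriv f e₃) ≠ 0 := fun h => hb3 (mem_tangentSpaceAt.2 h)
  have hg := isHomogeneous_dirDeriv hf e₃
  have hmix : ∀ Q ∈ S, eval Q.rep (dirDeriv (dirDeriv f e₃) P.rep) ≠ 0 := fun Q hQ =>
    dirDeriv_ne_zero_of_encard hg hlead hA hS (fun Q hQ => (hsing Q hQ).2 _) hQ
  have hinv : ∀ Q ∈ S, ∀ x y : ℂ,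
      eval (Q.rep + x • P.rep + y • e₂) f = eval (Q.rep + y • e₂) f := fun Q hQ x y => by
    rw [add_right_comm]
    exact hP.2.2 _ (T.add_mem (hLT (liesOn_iff.1 hQ.1)) (T.smul_mem _ hb2)) x
  -- The restriction of `f` to the tangent plane is a multiple of a `d`-fold line.
  have hplane : ∀ Q ∈ S, ∃ c : ℂ, ∀ x y : ℂ,
      eval (Q.rep + x • P.rep + y • e₂) f = c * y ^ d := fun Q hQ => by
    obtain ⟨c, hc⟩ := hQ.2.lineRestrict_eq hd hf (hinv Q hQ) hlead (hmix Q hQ)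
    refine ⟨c, fun x y => ?_⟩
    rw [hinv Q hQ, ← eval_lineRestrict, hc]
    simp
  obtain ⟨k, rfl⟩ : ∃ k, d = k + 3 := ⟨d - 3, by omega⟩
  set ξ₁ : V4 →ₗ[ℂ] ℂ := b.coord 1 with hξ₁
  set ξ₂ : V4 →ₗ[ℂ] ℂ := b.coord 2 with hξ₂
  have hξ₁p : ξ₁ P.rep = 0 := by rw [← hb0, hξ₁]; simp
  have hξ₂p : ξ₂ P.rep = 0 := by rw [← hb0, hξ₂]; simp
  have hξ₁e₁ : ξ₁ e₁ = 1 := by rw [← hb1, hξ₁]; simp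
  have hξ₂e₁ : ξ₂ e₁ = 0 := by rw [← hb1, hξ₂]; simp
  have hξ₁e₂ : ξ₁ e₂ = 0 := by rw [hξ₁]; simp [e₂]
  have hξ₂e₂ : ξ₂ e₂ = 1 := by rw [hξ₂]; simp [e₂]
  have hξ₁e₃ : ξ₁ e₃ = 0 := by rw [hξ₁]; simp [e₃]
  have hξ₂e₃ : ξ₂ e₃ = 0 := by rw [hξ₂]; simp [e₃]
  -- The exponent `k + 2` is `d - 1`.
  set ψ := perturbation ξ₁ ξ₂ (k + 2) with hψdef
  have hψ : ψ.IsHomogeneous (k + 3) := isHomogeneous_perturbation _ _ _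
  have hξ₂L : ∀ v ∈ L, ξ₂ v = 0 := fun v hv => by
    rw [hLspan, Submodule.mem_span_pair] at hv
    obtain ⟨x, y, rfl⟩ := hv
    simp [hξ₂p, hξ₂e₁]
  have hψL : ∀ v ∈ L, ∀ e, eval v (dirDeriv ψ e) = 0 := fun v hv e =>
    eval_dirDeriv_perturbation k (hξ₂L v hv) e
  have hψinv : ∀ v (c : ℂ), eval (v + c • P.rep) ψ = eval v ψ := fun v c => by
    rw [hψdef, eval_perturbation, eval_perturbation]
    simp [hξ₁p, hξ₂p]
  have hC : ∀ (t : ℂ) e, dirDeriv (C t * ψ) e = C t * dirDeriv ψ e := fun t e => by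
    rw [dirDeriv_mul, dirDeriv_C, mul_zero, add_zero]
  have hft : ∀ t : ℂ, (f + C t * ψ).IsHomogeneous (k + 3) := fun t => hf.add (hψ.C_mul t)
  have hstar : ∀ t : ℂ, IsSmoothStarPoint (f + C t * ψ) P := fun t =>
    hP.add (by rw [map_mul, hψdef, eval_perturbation, hξ₁p]; simp)
      (fun e => by rw [hC, map_mul, hψL _ hPL', mul_zero])
      (fun v c => by rw [map_mul, map_mul, hψinv, eval_C, eval_C])
  -- Both `ξ₁` and `ξ₂` vanish on `e₃`, so the perturbation leaves this derivative, and with it the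
  -- simple zeros on the line, unchanged.
  have hdir₃ : ∀ t : ℂ, dirDeriv (f + C t * ψ) e₃ = dirDeriv f e₃ := fun t => by
    rw [dirDeriv_add, hC, hψdef, dirDeriv_perturbation_eq_zero (k + 1) hξ₁e₃ hξ₂e₃, mul_zero,
      add_zero]
  have hne : ∀ t : ℂ, f + C t * ψ ≠ 0 := fun t h => by
    obtain ⟨i, hi⟩ := (hstar t).1.2
    rw [h] at hi
    simp at hi
  have hpe : LinearIndependent ℂ ![P.rep, e₁] := by
    have hvec : ![P.rep, e₁] = b ∘ ![0, 1] := by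
      funext j
      fin_cases j
      · exact hb0.symm
      · exact hb1.symm
    rw [hvec]
    exact b.linearIndependent.comp _ (by decide)
  have hcoef : ∀ Q ∈ S, ∃ c β : ℂ, β ≠ 0 ∧ ξ₁ Q.rep = β ∧ ξ₂ Q.rep = 0 ∧
      ∀ t x y : ℂ, eval (Q.rep + x • P.rep + y • e₂) (f + C t * ψ) =
        y ^ (k + 2) * (c * y + t * β) := fun Q hQ => by
    obtain ⟨c, hc⟩ := hplane Q hQ
    obtain ⟨β, s, hβ, hβs⟩ := hS Q hQ
    have h1 : ξ₁ Q.rep = β := by rw [hβs]; simp [hξ₁e₁, hξ₁p]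
    have h2 := hξ₂L _ (liesOn_iff.1 hQ.1)
    refine ⟨c, β, hβ, h1, h2, fun t x y => ?_⟩
    rw [map_add, map_mul, eval_C, hc, hψdef, eval_perturbation]
    simp only [map_add, map_smul, h1, h2, hξ₁p, hξ₂p, hξ₁e₂, hξ₂e₂, smul_eq_mul]
    ring
  obtain ⟨Q₀, hQ₀⟩ : S.Nonempty := by
    rw [← Set.encard_pos]
    refine lt_of_lt_of_le ?_ hA
    exact_mod_cast (by omega : 0 < k + 3 - 1)
  refine ⟨constantTripleFamily f ψ hf hψ hne hpe, ?_, ?_, ?_, fun t ht => ?_⟩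
  · rw [constantTripleFamily_X]; simp
  · rw [constantTripleFamily_line, hLspan]
  · rw [constantTripleFamily_point, P.mk_rep]
  rw [constantTripleFamily_X, constantTripleFamily_line, constantTripleFamily_point, P.mk_rep,
    ← hLspan]
  refine ⟨?_, le_antisymm ?_ ?_, hPL, hstar t⟩
  · obtain ⟨c, β, hβ, -, -, hc⟩ := hcoef Q₀ hQ₀
    -- One of `y = 1` and `y = -1` works: the two linear factors sum to `2 t β`, which is nonzero.
    obtain ⟨y, hy⟩ : ∃ y : ℂ, y ^ (k + 2) * (c * y + t * β) ≠ 0 := by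
      by_contra! h
      have h1 := h 1
      have h2 := (mul_eq_zero.1 (h (-1))).resolve_left (pow_ne_zero _ (by norm_num))
      exact mul_ne_zero ht hβ (by linear_combination h1 / 2 + h2 / 2)
    refine irreducible_of_smooth_of_invariant (hft t) (hstar t).1.1 (e := e₃)
      (v := Q₀.rep + y • e₂) (by rw [hdir₃]; exact hlead) (fun x => ?_) ?_
    · rw [add_right_comm, hc]
      have := hc t 0 y
      rw [zero_smul, add_zero] at this
      exact this.symm
    · have := hc t 0 y
      rw [zero_smul, add_zero] at this
      rwa [this]
  -- Upper bound: every singularity on the line is a root of the `e₃`-derivative, which has degree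
  -- at most `d - 1` there.
  · have hr0 : lineRestrict (dirDeriv f e₃) e₁ P.rep ≠ 0 := fun h => hlead (by
      rw [← coeff_lineRestrict hg e₁ P.rep, h, Polynomial.coeff_zero])
    refine (encard_le_natDegree (p := P.rep) (e₁ := e₁) hr0 fun Q hQ => ?_).trans
      (by exact_mod_cast natDegree_lineRestrict_le hg e₁ P.rep)
    have hz : eval Q.rep (dirDeriv f e₃) = 0 := by
      rw [← hdir₃ t]
      exact (hQ.2.eval_eq_zero (hft t) (by omega)).2 e₃
    obtain ⟨β, s, hβ, hβs⟩ := exists_affine_coordinate hLspan hg hlead hQ.1 hz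
    exact ⟨β, s, hβ, hβs, isRoot_lineRestrict hg hβ hβs hz⟩
  -- Lower bound: each of the original singularities becomes one of type `A_{d-2}`.
  · refine hA.trans (Set.encard_le_encard fun Q hQ => ⟨hQ.1, ?_⟩)
    obtain ⟨c, β, hβ, hβ', h2, hc⟩ := hcoef Q hQ
    refine isTypeA_of_eval_plane (e₀ := P.rep) (e₂ := e₂) (e₃ := e₃) ?_ (mul_ne_zero ht hβ) (hc t)
      (by rw [hdir₃]; exact (hsing Q hQ).2 e₃) (by rw [hdir₃]; exact hmix Q hQ)
    refine linearIndependent_finCons.2 ⟨?_, fun hmem => ?_⟩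
    · have hvec : ![P.rep, e₂, e₃] = b ∘ ![0, 2, 3] := by
        funext j
        fin_cases j
        · exact hb0.symm
        · rfl
        · rfl
      rw [hvec]
      exact b.linearIndependent.comp _ (by decide)
    · have hle : Submodule.span ℂ (Set.range ![P.rep, e₂, e₃]) ≤ LinearMap.ker ξ₁ := by
        rw [Submodule.span_le]
        rintro _ ⟨j, rfl⟩
        fin_cases j
        · exact hξ₁p
        · exact hξ₁e₂
        · exact hξ₁e₃
      exact hβ (hβ' ▸ hle hmem)

end
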